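/- Let $k$ be a field, $\mathfrak h$ a finite-dimensional left Leibniz $k$-algebra (a vector space with a bilinear bracket satisfying $[x,[y,z]]=[[x,y],z]+[y,[x,z]]$), $\mathbf b=(x_1,\dots,x_n)$ a basis of $\mathfrak h$, and $[x_i,x_j]=\sum_l C^l_{ij}x_l$. Let $\mathfrak h_{Lie}$ be the Lie algebra obtained as the quotient of $\mathfrak h$ by the two-sided ideal generated by all $[x,x]$; let $\tilde x$ denote the image of $x\in\mathfrak h$ in $U(\mathfrak h_{Lie})$, which is a bialgebra with all $\tilde x$ primitive. Let $\mathcal O(\mathrm{Aut}(\mathfrak h))$, presented in the basis $\mathbf b$, be the commutative $k$-algebra with generators $\mathcal G^i_j,\bar{\mathcal G}^i_j$ ($1\le i,j\le n$) and relations $$\sum_{l,m}C^p_{lm}\mathcal G^l_i\mathcal G^m_j=\sum_r\mathcal G^p_rC^r_{ij},\qquad \sum_l\mathcal G^i_l\bar{\mathcal G}^l_j=\delta^i_j=\sum_l\bar{\mathcal G}^i_l\mathcal G^l_j ,$$ a Hopf algebra via the algebra maps with $\Delta(\mathcal G^i_j)=\sum_l\mathcal G^i_l\otimes\mathcal G^l_j$,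 $\Delta(\bar{\mathcal G}^i_j)=\sum_l\bar{\mathcal G}^l_j\otimes\bar{\mathcal G}^i_l$, $\epsilon(\mathcal G^i_j)=\epsilon(\bar{\mathcal G}^i_j)=\delta^i_j$, $S(\mathcal G^i_j)=\bar{\mathcal G}^i_j$, $S(\bar{\mathcal G}^i_j)=\mathcal G^i_j$. Write $U=U(\mathfrak h_{Lie})$ and $\mathcal O=\mathcal O(\mathrm{Aut}(\mathfrak h))$. A Hopf pairing $\langle-,-\rangle\colon U\otimes\mathcal O\to k$ is a bilinear map with $\langle u,fg\rangle=\langle u_{(1)},f\rangle\langle u_{(2)},g\rangle$, $\langle u,1\rangle=\epsilon(u)$, $\langle uv,f\rangle=\langle u,f_{(1)}\rangle\langle v,f_{(2)}\rangle$ and $\langle 1,f\rangle=\epsilon(f)$. There is a unique Hopf pairing with $\langle\tilde x_l,\mathcal G^i_j\rangle=C^i_{lj}$ for all $i,j,l$, and for this pairing the following holds. 1. The formula $u\blacktriangleleft f:=\langle u_{(1)},f\rangle u_{(2)}$ defines a right Hopf action of $\mathcal O$ on $U$: it is a unital right module structure with $(uv)\blacktriangleleft f=(u\blacktriangleleft f_{(1)})(v\blacktriangleleft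 f_{(2)})$ and $1\blacktriangleleft f=\epsilon(f)1$. Hence there is a smash product algebra $\mathcal O\sharp U$: the space $\mathcal O\otimes U$ is an associative algebra with unit $1\sharp1$ under $(f\sharp u)(g\sharp v)=fg_{(1)}\sharp(u\blacktriangleleft g_{(2)})v$. 2. There is a unique $k$-linear unital antimultiplicative map $\lambda\colon U\to\mathcal O\sharp U$ with $\lambda(\tilde x_j)=\sum_i\bar{\mathcal G}^i_j\sharp\tilde x_i$ for all $j$. 3. Every element of $\operatorname{Im}\lambda$ commutes with every element of $1\sharp U$ in $\mathcal O\sharp U$. 4. Regarded as a map $U\to\mathcal O\otimes U$, $u\mapsto u_{[-1]}\otimes u_{[0]}$, $\lambda$ is a left $\mathcal O$-coaction (coassociative and counital). 5. $(U,\blacktriangleleft,\lambda)$ is a braided commutative right-left Yetter–Drinfeld module algebra over $\mathcal O$: in addition to 1 and 4, for all $u,v\in U$, $f\in\mathcal O$, $$f_{(2)}(u\blacktriangleleft f_{(1)})_{[-1]}\otimes(u\blacktriangleleft f_{(1)})_{[0]}=u_{[-1]}f_{(1)}\otimes(u_{[0]}\blacktriangleleft f_{(2)}),$$ $$\lambda(uv)=v_{[-1]}u_{[-1]}\otimes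 u_{[0]}v_{[0]},\qquad\lambda(1)=1\otimes1,\qquad (u\blacktriangleleft v_{[-1]})v_{[0]}=vu .$$ 6. The pairing, the action $\blacktriangleleft$, the smash product and $\lambda$ do not depend on the basis: if $\mathbf b'=(x'_1,\dots,x'_n)$ is another basis, $x'_j=\sum_iT^i_jx_i$, there is a Hopf algebra isomorphism $\theta$ from $\mathcal O(\mathrm{Aut}(\mathfrak h))$ presented in $\mathbf b'$ to $\mathcal O(\mathrm{Aut}(\mathfrak h))$ presented in $\mathbf b$ with $\theta(\mathcal G'^i_j)=\sum_{l,m}(T^{-1})^i_l\,\mathcal G^l_m\,T^m_j$, which carries the pairing and the action built from $\mathbf b'$ to those built from $\mathbf b$, and $\theta\otimes\mathrm{id}_U$ is multiplicative for the smash products and carries $\lambda_{\mathbf b'}$ to $\lambda_{\mathbf b}$. -/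

import Mathlib

open scoped TensorProduct

noncomputable section

namespace LeibnizYD

/-! ### Left Leibniz algebras and their maximal Lie quotient -/

/-- A left Leibniz algebra: a `k`-bilinear bracket such that each `[x, -]` is a derivation. -/
class LeftLeibnizAlgebra (k h : Type*) [CommRing k] [AddCommGroup h] [Module k h] where
  bracket : h →ₗ[k] h →ₗ[k] h
  leibniz : ∀ x y z : h,
    bracket x (bracket y z) = bracket (bracket x y) z + bracket y (bracket x z)

section Leibniz

variable (k h : Type*) [CommRing k] [AddCommGroup h] [Module k h] [LeftLeibnizAlgebra k h]

/-- The bracket of a left Leibniz algebra, as a bilinear map. -/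
abbrev lbr : h →ₗ[k] h →ₗ[k] h := LeftLeibnizAlgebra.bracket

/-- The smallest two-sided ideal containing all `[x, x]`. -/
def squaresIdeal : Submodule k h :=
  sInf {I : Submodule k h | (∀ x, lbr k h x x ∈ I) ∧
    ∀ a, ∀ x ∈ I, lbr k h a x ∈ I ∧ lbr k h x a ∈ I}

variable {k h} in
theorem sq_mem_squaresIdeal (x : h) : lbr k h x x ∈ squaresIdeal k h :=
  Submodule.mem_sInf.2 fun _ hI => hI.1 x

variable {k h} in
theorem lbr_mem_left (a : h) {x : h} (hx : x ∈ squaresIdeal k h) :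
    lbr k h a x ∈ squaresIdeal k h :=
  Submodule.mem_sInf.2 fun I hI => (hI.2 a x (Submodule.mem_sInf.1 hx I hI)).1

variable {k h} in
theorem lbr_mem_right (a : h) {x : h} (hx : x ∈ squaresIdeal k h) :
    lbr k h x a ∈ squaresIdeal k h :=
  Submodule.mem_sInf.2 fun I hI => (hI.2 a x (Submodule.mem_sInf.1 hx I hI)).2

/-- The Lie algebra `h_Lie`: the quotient of `h` by the ideal generated by all `[x, x]`. -/
def HLie : Type _ := h ⧸ squaresIdeal k h

instance : AddCommGroup (HLie k h) := inferInstanceAs (AddCommGroup (h ⧸ squaresIdeal k h))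

instance : Module k (HLie k h) := inferInstanceAs (Module k (h ⧸ squaresIdeal k h))

/-- The quotient map `h → h_Lie`. -/
def toHLie : h →ₗ[k] HLie k h := (squaresIdeal k h).mkQ

theorem toHLie_surjective : Function.Surjective (toHLie k h) := (squaresIdeal k h).mkQ_surjective

/-- The bracket of `h_Lie`, induced from that of `h`. -/
def hLieBracket : HLie k h →ₗ[k] HLie k h →ₗ[k] HLie k h :=
  (squaresIdeal k h).liftQ
    { toFun := fun x => (squaresIdeal k h).mapQ (squaresIdeal k h) (lbr k h x)
        fun _ hy => lbr_mem_left x hy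
      map_add' := fun x y => by
        apply Submodule.linearMap_qext
        ext z
        exact congrArg (squaresIdeal k h).mkQ (congrArg (fun f => f z) (map_add (lbr k h) x y))
      map_smul' := fun c x => by
        apply Submodule.linearMap_qext
        ext z
        exact congrArg (squaresIdeal k h).mkQ (congrArg (fun f => f z) (map_smul (lbr k h) c x)) }
    (fun x hx => by
      rw [LinearMap.mem_ker]
      apply Submodule.linearMap_qext
      ext z
      exact (Submodule.Quotient.mk_eq_zero _).2 (lbr_mem_right z hx))

theorem hLieBracket_toHLie (x y : h) :
    hLieBracket k h (toHLie k h x) (toHLie k h y) = toHLie k h (lbr k h x y) := rfl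

instance : LieRing (HLie k h) where
  bracket x y := hLieBracket k h x y
  add_lie x y z := congrArg (fun f => f z) (map_add (hLieBracket k h) x y)
  lie_add x y z := map_add _ _ _
  lie_self x := by
    obtain ⟨x, rfl⟩ := toHLie_surjective k h x
    exact (Submodule.Quotient.mk_eq_zero _).2 (sq_mem_squaresIdeal x)
  leibniz_lie x y z := by
    obtain ⟨x, rfl⟩ := toHLie_surjective k h x
    obtain ⟨y, rfl⟩ := toHLie_surjective k h y
    obtain ⟨z, rfl⟩ := toHLie_surjective k h z
    exact (congrArg (toHLie k h) (LeftLeibnizAlgebra.leibniz x y z)).trans (map_add _ _ _)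

instance : LieAlgebra k (HLie k h) where
  lie_smul c _ y := map_smul _ c y

theorem toHLie_lbr (x y : h) : toHLie k h (lbr k h x y) = ⁅toHLie k h x, toHLie k h y⁆ := rfl

end Leibniz

/-! ### The enveloping algebra as a bialgebra -/

section Enveloping

variable (k g : Type*) [CommRing k] [LieRing g] [LieAlgebra k g]

attribute [local instance] LieRing.ofAssociativeRing

variable {k g} in
theorem enveloping_algHom_ext {A : Type*} [Ring A] [Algebra k A]
    {f f' : UniversalEnvelopingAlgebra k g →ₐ[k] A}
    (H : ∀ x : g, f (UniversalEnvelopingAlgebra.ι k x) = f' (UniversalEnvelopingAlgebra.ι k x)) :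
    f = f' :=
  UniversalEnvelopingAlgebra.hom_ext k (LieHom.ext H)

/-- The Lie algebra map `x ↦ x ⊗ 1 + 1 ⊗ x`. -/
def primitiveHom : g →ₗ⁅k⁆
    UniversalEnvelopingAlgebra k g ⊗[k] UniversalEnvelopingAlgebra k g :=
  { toLinearMap := (TensorProduct.mk k (UniversalEnvelopingAlgebra k g)
        (UniversalEnvelopingAlgebra k g)).flip 1 ∘ₗ
          (UniversalEnvelopingAlgebra.ι k (L := g)).toLinearMap +
      TensorProduct.mk k (UniversalEnvelopingAlgebra k g) (UniversalEnvelopingAlgebra k g) 1 ∘ₗ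
          (UniversalEnvelopingAlgebra.ι k (L := g)).toLinearMap
    map_lie' := by
      intro x y
      change UniversalEnvelopingAlgebra.ι k ⁅x, y⁆ ⊗ₜ[k] 1
          + 1 ⊗ₜ[k] UniversalEnvelopingAlgebra.ι k ⁅x, y⁆ =
        ⁅UniversalEnvelopingAlgebra.ι k x ⊗ₜ[k] 1 + 1 ⊗ₜ[k] UniversalEnvelopingAlgebra.ι k x,
          UniversalEnvelopingAlgebra.ι k y ⊗ₜ[k] 1 + 1 ⊗ₜ[k] UniversalEnvelopingAlgebra.ι k y⁆
      rw [LieHom.map_lie, LieRing.of_associative_ring_bracket,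
        LieRing.of_associative_ring_bracket]
      simp only [mul_add, add_mul, Algebra.TensorProduct.tmul_mul_tmul, mul_one, one_mul,
        TensorProduct.sub_tmul, TensorProduct.tmul_sub]
      abel }

theorem primitiveHom_apply (x : g) : primitiveHom k g x =
    UniversalEnvelopingAlgebra.ι k x ⊗ₜ[k] 1 + 1 ⊗ₜ[k] UniversalEnvelopingAlgebra.ι k x := rfl

/-- `U(g)` with elements of `g` primitive. -/
instance : Bialgebra k (UniversalEnvelopingAlgebra k g) :=
  .ofAlgHom (UniversalEnvelopingAlgebra.lift k (primitiveHom k g))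
    (UniversalEnvelopingAlgebra.lift k (0 : g →ₗ⁅k⁆ k))
    (by
      apply enveloping_algHom_ext
      intro x
      simp [-UniversalEnvelopingAlgebra.ι_apply, UniversalEnvelopingAlgebra.lift_ι_apply,
        primitiveHom_apply, Algebra.TensorProduct.one_def, TensorProduct.add_tmul,
        TensorProduct.tmul_add]
      abel)
    (by
      apply enveloping_algHom_ext
      intro x
      simp [-UniversalEnvelopingAlgebra.ι_apply, UniversalEnvelopingAlgebra.lift_ι_apply,
        primitiveHom_apply])
    (by
      apply enveloping_algHom_ext
      intro x
      simp [-UniversalEnvelopingAlgebra.ι_apply, UniversalEnvelopingAlgebra.lift_ι_apply,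
        primitiveHom_apply])

theorem comul_ι (x : g) :
    Coalgebra.comul (R := k) (UniversalEnvelopingAlgebra.ι k x) =
      UniversalEnvelopingAlgebra.ι k x ⊗ₜ[k] 1 + 1 ⊗ₜ[k] UniversalEnvelopingAlgebra.ι k x :=
  UniversalEnvelopingAlgebra.lift_ι_apply k (primitiveHom k g) x

theorem counit_ι (x : g) :
    Coalgebra.counit (R := k) (UniversalEnvelopingAlgebra.ι k x) = 0 :=
  UniversalEnvelopingAlgebra.lift_ι_apply k (0 : g →ₗ⁅k⁆ k) x

end Enveloping

/-! ### The Hopf algebra of regular functions on the automorphism group -/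

section AutAlg

variable {k : Type*} [CommRing k] {n : ℕ}

/-- The pair `(M, N)` of matrices over the commutative `k`-algebra `A` consists of mutually inverse
matrices, and `M` (acting on columns) is multiplicative for the product on `Aⁿ` with structure
constants `C i j l = C^l_{ij}`, that is `x_i x_j = ∑_l C^l_{ij} x_l`. -/
structure IsAutPair (C : Fin n → Fin n → Fin n → k) {A : Type*} [CommRing A] [Algebra k A]
    (M N : Matrix (Fin n) (Fin n) A) : Prop where
  mul_inv : ∀ i j, ∑ l, M i l * N l j = if i = j then 1 else 0
  inv_mul : ∀ i j, ∑ l, N i l * M l j = if i = j then 1 else 0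
  hom : ∀ i j p, ∑ l, ∑ m, algebraMap k A (C l m p) * (M l i * M m j) =
    ∑ r, M p r * algebraMap k A (C i j r)

/-- The defining relations of `O(Aut(L))` in the free commutative algebra on the entries of two
matrices of indeterminates: `X (inl (i, j))` is `G^i_j` and `X (inr (i, j))` is `Ḡ^i_j`. -/
inductive AutRel (C : Fin n → Fin n → Fin n → k) :
    MvPolynomial ((Fin n × Fin n) ⊕ (Fin n × Fin n)) k → Prop
  | mul_inv (i j : Fin n) : AutRel C
      (∑ l, MvPolynomial.X (.inl (i, l)) * MvPolynomial.X (.inr (l, j)) - if i = j then 1 else 0)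
  | inv_mul (i j : Fin n) : AutRel C
      (∑ l, MvPolynomial.X (.inr (i, l)) * MvPolynomial.X (.inl (l, j)) - if i = j then 1 else 0)
  | hom (i j p : Fin n) : AutRel C
      (∑ l, ∑ m, MvPolynomial.C (C l m p) *
          (MvPolynomial.X (.inl (l, i)) * MvPolynomial.X (.inl (m, j))) -
        ∑ r, MvPolynomial.X (.inl (p, r)) * MvPolynomial.C (C i j r))

/-- The commutative algebra with generators `G^i_j`, `Ḡ^i_j` and relations
`∑ C^p_{lm} G^l_i G^m_j = ∑ G^p_r C^r_{ij}` and `G Ḡ = 1 = Ḡ G`. -/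
def AutAlg (C : Fin n → Fin n → Fin n → k) : Type _ :=
  MvPolynomial ((Fin n × Fin n) ⊕ (Fin n × Fin n)) k ⧸ Ideal.span {p | AutRel C p}

variable (C : Fin n → Fin n → Fin n → k)

instance : CommRing (AutAlg C) := inferInstanceAs
  (CommRing (MvPolynomial ((Fin n × Fin n) ⊕ (Fin n × Fin n)) k ⧸ Ideal.span {p | AutRel C p}))

instance : Algebra k (AutAlg C) := inferInstanceAs
  (Algebra k (MvPolynomial ((Fin n × Fin n) ⊕ (Fin n × Fin n)) k ⧸ Ideal.span {p | AutRel C p}))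

namespace AutAlg

/-- The quotient map from the polynomial algebra. -/
def mk : MvPolynomial ((Fin n × Fin n) ⊕ (Fin n × Fin n)) k →ₐ[k] AutAlg C :=
  Ideal.Quotient.mkₐ k _

/-- The generator `G^i_j`. -/
def G (i j : Fin n) : AutAlg C := mk C (MvPolynomial.X (.inl (i, j)))

/-- The generator `Ḡ^i_j`. -/
def Gbar (i j : Fin n) : AutAlg C := mk C (MvPolynomial.X (.inr (i, j)))

theorem mk_eq_zero {p : MvPolynomial ((Fin n × Fin n) ⊕ (Fin n × Fin n)) k} (hp : AutRel C p) :
    mk C p = 0 :=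
  Ideal.Quotient.eq_zero_iff_mem.2 (Ideal.subset_span hp)

theorem mk_C (c : k) : mk C (MvPolynomial.C c) = algebraMap k (AutAlg C) c :=
  (mk C).commutes c

theorem isAutPair : IsAutPair C (Matrix.of (G C)) (Matrix.of (Gbar C)) where
  mul_inv i j := by
    have := mk_eq_zero C (AutRel.mul_inv i j)
    rw [map_sub, sub_eq_zero] at this
    simpa [G, Gbar, apply_ite (mk C)] using this
  inv_mul i j := by
    have := mk_eq_zero C (AutRel.inv_mul i j)
    rw [map_sub, sub_eq_zero] at this
    simpa [G, Gbar, apply_ite (mk C)] using this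
  hom i j p := by
    have := mk_eq_zero C (AutRel.hom i j p)
    rw [map_sub, sub_eq_zero] at this
    simpa [G, Gbar, mk_C] using this

section lift

variable {C} {A : Type*} [CommRing A] [Algebra k A] {M N : Matrix (Fin n) (Fin n) A}

/-- The algebra map `G ↦ M`, `Ḡ ↦ N`. -/
def lift (hMN : IsAutPair C M N) : AutAlg C →ₐ[k] A :=
  Ideal.Quotient.liftₐ _ (MvPolynomial.aeval (Sum.elim (fun p => M p.1 p.2) fun p => N p.1 p.2))
    (fun a ha => by
      have : Ideal.span {p | AutRel C p} ≤ RingHom.ker (MvPolynomial.aeval (R := k)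
          (Sum.elim (fun p : Fin n × Fin n => M p.1 p.2) fun p : Fin n × Fin n => N p.1 p.2)) := by
        rw [Ideal.span_le]
        rintro p (⟨i, j⟩ | ⟨i, j⟩ | ⟨i, j, p⟩)
        · simpa [sub_eq_zero, apply_ite, RingHom.mem_ker] using hMN.mul_inv i j
        · simpa [sub_eq_zero, apply_ite, RingHom.mem_ker] using hMN.inv_mul i j
        · simpa [sub_eq_zero, RingHom.mem_ker] using hMN.hom i j p
      exact this ha)

@[simp] theorem lift_G (hMN : IsAutPair C M N) (i j : Fin n) : lift hMN (G C i j) = M i j := by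
  change MvPolynomial.aeval _ (MvPolynomial.X _) = _
  simp

@[simp] theorem lift_Gbar (hMN : IsAutPair C M N) (i j : Fin n) :
    lift hMN (Gbar C i j) = N i j := by
  change MvPolynomial.aeval _ (MvPolynomial.X _) = _
  simp

theorem algHom_ext {A : Type*} [Semiring A] [Algebra k A] {f g : AutAlg C →ₐ[k] A}
    (h1 : ∀ i j, f (G C i j) = g (G C i j))
    (h2 : ∀ i j, f (Gbar C i j) = g (Gbar C i j)) : f = g := by
  apply Ideal.Quotient.algHom_ext
  ext (⟨i, j⟩ | ⟨i, j⟩)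
  · exact h1 i j
  · exact h2 i j

end lift

end AutAlg

namespace IsAutPair

open scoped Kronecker

variable {C} {A : Type*} [CommRing A] [Algebra k A] {M N M' N' : Matrix (Fin n) (Fin n) A}

/-- The structure constants as an `n × n²` matrix. -/
def cMat (C : Fin n → Fin n → Fin n → k) (A : Type*) [CommRing A] [Algebra k A] :
    Matrix (Fin n) (Fin n × Fin n) A := Matrix.of fun p q => algebraMap k A (C q.1 q.2 p)

theorem iff_matrix : IsAutPair C M N ↔
    M * N = 1 ∧ N * M = 1 ∧ cMat C A * (M ⊗ₖ M) = M * cMat C A := by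
  constructor
  · rintro ⟨h1, h2, h3⟩
    refine ⟨?_, ?_, ?_⟩
    · ext i j; simpa [Matrix.mul_apply, Matrix.one_apply] using h1 i j
    · ext i j; simpa [Matrix.mul_apply, Matrix.one_apply] using h2 i j
    · ext p ⟨i, j⟩
      simpa [Matrix.mul_apply, cMat, Fintype.sum_prod_type] using h3 i j p
  · rintro ⟨h1, h2, h3⟩
    refine ⟨fun i j => ?_, fun i j => ?_, fun i j p => ?_⟩
    · simpa [Matrix.mul_apply, Matrix.one_apply] using congrFun₂ h1 i j
    · simpa [Matrix.mul_apply, Matrix.one_apply] using congrFun₂ h2 i j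
    · simpa [Matrix.mul_apply, cMat, Fintype.sum_prod_type] using congrFun₂ h3 p (i, j)

theorem one : IsAutPair C (1 : Matrix (Fin n) (Fin n) A) 1 := by
  rw [iff_matrix]; simp

theorem mul (h1 : IsAutPair C M N) (h2 : IsAutPair C M' N') :
    IsAutPair C (M * M') (N' * N) := by
  rw [iff_matrix] at *
  obtain ⟨a1, a2, a3⟩ := h1
  obtain ⟨b1, b2, b3⟩ := h2
  refine ⟨?_, ?_, ?_⟩
  · rw [Matrix.mul_assoc, ← Matrix.mul_assoc M', b1, Matrix.one_mul, a1]
  · rw [Matrix.mul_assoc, ← Matrix.mul_assoc N, a2, Matrix.one_mul, b2]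
  · rw [Matrix.mul_kronecker_mul, ← Matrix.mul_assoc, a3, Matrix.mul_assoc, b3, Matrix.mul_assoc]

theorem inv (h1 : IsAutPair C M N) : IsAutPair C N M := by
  rw [iff_matrix] at *
  obtain ⟨a1, a2, a3⟩ := h1
  refine ⟨a2, a1, ?_⟩
  calc cMat C A * (N ⊗ₖ N) = N * (M * cMat C A) * (N ⊗ₖ N) := by
        rw [← Matrix.mul_assoc N, a2, Matrix.one_mul]
    _ = N * cMat C A * ((M * N) ⊗ₖ (M * N)) := by
        rw [← a3, Matrix.mul_kronecker_mul]; simp only [Matrix.mul_assoc]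
    _ = N * cMat C A := by rw [a1]; simp

theorem map {B : Type*} [CommRing B] [Algebra k B] (f : A →ₐ[k] B) (h1 : IsAutPair C M N) :
    IsAutPair C (M.map f) (N.map f) where
  mul_inv i j := by simpa [apply_ite f] using congrArg f (h1.mul_inv i j)
  inv_mul i j := by simpa [apply_ite f] using congrArg f (h1.inv_mul i j)
  hom i j p := by simpa using congrArg f (h1.hom i j p)

end IsAutPair

namespace AutAlg

/-- `Δ(G^i_j) = ∑ G^i_l ⊗ G^l_j`, `Δ(Ḡ^i_j) = ∑ Ḡ^l_j ⊗ Ḡ^i_l`. -/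
def comulHom : AutAlg C →ₐ[k] AutAlg C ⊗[k] AutAlg C :=
  lift (((isAutPair C).map Algebra.TensorProduct.includeLeft).mul
    ((isAutPair C).map Algebra.TensorProduct.includeRight))

/-- `ε(G^i_j) = ε(Ḡ^i_j) = δ^i_j`. -/
def counitHom : AutAlg C →ₐ[k] k := lift (IsAutPair.one (C := C) (A := k))

/-- `S(G^i_j) = Ḡ^i_j`, `S(Ḡ^i_j) = G^i_j`. -/
def antipodeHom : AutAlg C →ₐ[k] AutAlg C := lift (isAutPair C).inv

@[simp] theorem comulHom_G (i j : Fin n) :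
    comulHom C (G C i j) = ∑ l, G C i l ⊗ₜ[k] G C l j := by
  simp [comulHom, Matrix.mul_apply]

@[simp] theorem comulHom_Gbar (i j : Fin n) :
    comulHom C (Gbar C i j) = ∑ l, Gbar C l j ⊗ₜ[k] Gbar C i l := by
  simp [comulHom, Matrix.mul_apply]

@[simp] theorem counitHom_G (i j : Fin n) :
    counitHom C (G C i j) = if i = j then 1 else 0 := by
  simp [counitHom, Matrix.one_apply]

@[simp] theorem counitHom_Gbar (i j : Fin n) :
    counitHom C (Gbar C i j) = if i = j then 1 else 0 := by
  simp [counitHom, Matrix.one_apply]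

@[simp] theorem antipodeHom_G (i j : Fin n) : antipodeHom C (G C i j) = Gbar C i j := by
  simp [antipodeHom]

@[simp] theorem antipodeHom_Gbar (i j : Fin n) : antipodeHom C (Gbar C i j) = G C i j := by
  simp [antipodeHom]

instance : Bialgebra k (AutAlg C) :=
  .ofAlgHom (comulHom C) (counitHom C)
    (by
      apply algHom_ext <;> intro i j
      · simp [TensorProduct.sum_tmul, TensorProduct.tmul_sum]
        exact Finset.sum_comm
      · simp [TensorProduct.sum_tmul, TensorProduct.tmul_sum]
        exact Finset.sum_comm)
    (by apply algHom_ext <;> intro i j <;> simp [TensorProduct.ite_tmul])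
    (by apply algHom_ext <;> intro i j <;> simp [TensorProduct.tmul_ite])

instance : HopfAlgebra k (AutAlg C) :=
  .ofAlgHom (antipodeHom C)
    (by
      apply algHom_ext <;> intro i j
      · change Algebra.TensorProduct.lift _ _ (fun _ _ => Commute.all _ _) (comulHom C _) = algebraMap _ _ (counitHom C _)
        simpa [apply_ite] using (isAutPair C).inv_mul i j
      · change Algebra.TensorProduct.lift _ _ (fun _ _ => Commute.all _ _) (comulHom C _) = algebraMap _ _ (counitHom C _)
        simpa [apply_ite, mul_comm] using (isAutPair C).inv_mul i j)
    (by
      apply algHom_ext <;> intro i j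
      · change Algebra.TensorProduct.lift _ _ (fun _ _ => Commute.all _ _) (comulHom C _) = algebraMap _ _ (counitHom C _)
        simpa [apply_ite] using (isAutPair C).mul_inv i j
      · change Algebra.TensorProduct.lift _ _ (fun _ _ => Commute.all _ _) (comulHom C _) = algebraMap _ _ (counitHom C _)
        simpa [apply_ite, mul_comm] using (isAutPair C).mul_inv i j)

end AutAlg

end AutAlg

/-! ### Hopf pairings, module algebras, smash products -/

section Hopf

variable {k B H A : Type*} [CommRing k] [Ring B] [Bialgebra k B] [Ring H] [Bialgebra k H]
  [Ring A] [Algebra k A]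

/-- The pairing of `B ⊗ B` with `H ⊗ H` given by `⟨b ⊗ c, f ⊗ g⟩ = ⟨b, f⟩⟨c, g⟩`. -/
def pairing₂ (P : B →ₗ[k] H →ₗ[k] k) : B ⊗[k] B →ₗ[k] H ⊗[k] H →ₗ[k] k :=
  (TensorProduct.map₂ P P).compr₂ (TensorProduct.lid k k).toLinearMap

theorem pairing₂_tmul (P : B →ₗ[k] H →ₗ[k] k) (b c : B) (f g : H) :
    pairing₂ P (b ⊗ₜ c) (f ⊗ₜ g) = P b f * P c g := by
  simp [pairing₂]

/-- A Hopf pairing between two bialgebras (possibly degenerate). -/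
structure IsHopfPairing (P : B →ₗ[k] H →ₗ[k] k) : Prop where
  comul_left : ∀ b f g, pairing₂ P (Coalgebra.comul b) (f ⊗ₜ g) = P b (f * g)
  one_right : ∀ b, P b 1 = Coalgebra.counit b
  comul_right : ∀ b c f, pairing₂ P (b ⊗ₜ c) (Coalgebra.comul f) = P (b * c) f
  one_left : ∀ f, P 1 f = Coalgebra.counit f

/-- The map `u ◁ f = ∑ ⟨u₍₁₎, f⟩ u₍₂₎`. -/
def pairingAction (P : B →ₗ[k] H →ₗ[k] k) : B →ₗ[k] H →ₗ[k] B :=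
  LinearMap.flip
    { toFun := fun f => (TensorProduct.lid k B).toLinearMap ∘ₗ
        (P.flip f).rTensor B ∘ₗ Coalgebra.comul
      map_add' := fun f g => by ext; simp [LinearMap.rTensor_add]
      map_smul' := fun c f => by ext; simp [LinearMap.rTensor_smul] }

/-- `act : A → H → A` (written `a ◁ f`) makes `A` a right `H`-module algebra, that is, it is a
right Hopf action on the algebra `A`. -/
structure IsRightModuleAlgebra (act : A →ₗ[k] H →ₗ[k] A) : Prop where
  act_one : ∀ a, act a 1 = a
  act_mul : ∀ a f g, act a (f * g) = act (act a f) g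
  /-- `(a c) ◁ f = ∑ (a ◁ f₍₁₎) (c ◁ f₍₂₎)` -/
  mul_act : ∀ a c f, act (a * c) f =
    LinearMap.mul' k A (TensorProduct.map (act a) (act c) (Coalgebra.comul f))
  one_act : ∀ f : H, act 1 f = Coalgebra.counit (R := k) f • (1 : A)

/-- The smash product multiplication on `H ⊗ A`:
`(f ♯ a) (g ♯ c) = ∑ f g₍₁₎ ♯ (a ◁ g₍₂₎) c`. -/
def smashMul (act : A →ₗ[k] H →ₗ[k] A) : H ⊗[k] A →ₗ[k] H ⊗[k] A →ₗ[k] H ⊗[k] A where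
  toFun s := (LinearMap.mul' k A).lTensor H ∘ₗ
    (TensorProduct.assoc k H A A).toLinearMap ∘ₗ
    (TensorProduct.map₂ (LinearMap.mul k H) act s).rTensor A ∘ₗ
    (Coalgebra.comul (R := k) (A := H)).rTensor A
  map_add' s t := by
    simp [LinearMap.rTensor_add, LinearMap.add_comp, LinearMap.comp_add]
  map_smul' c s := by
    simp [LinearMap.rTensor_smul, LinearMap.smul_comp, LinearMap.comp_smul]

theorem smashMul_tmul (act : A →ₗ[k] H →ₗ[k] A) (f g : H) (a c : A) :
    smashMul act (f ⊗ₜ a) (g ⊗ₜ c) =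
      TensorProduct.map (LinearMap.mulLeft k f) (LinearMap.mulRight k c ∘ₗ act a)
        (Coalgebra.comul g) := by
  simp only [smashMul, LinearMap.coe_mk, AddHom.coe_mk, LinearMap.comp_apply,
    LinearMap.rTensor_tmul]
  induction Coalgebra.comul (R := k) g with
  | zero => simp
  | add x y hx hy => simp only [map_add, TensorProduct.add_tmul, hx, hy]
  | tmul x y => simp

/-- The bilinear product `μ` with unit `e` makes the module `M` an associative unital algebra. -/
structure IsAssocUnital {M : Type*} [AddCommGroup M] [Module k M]
    (μ : M →ₗ[k] M →ₗ[k] M) (e : M) : Prop where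
  assoc : ∀ x y z, μ (μ x y) z = μ x (μ y z)
  one_mul : ∀ x, μ e x = x
  mul_one : ∀ x, μ x e = x

/-- `lam : A → H ⊗ A`, `a ↦ ∑ a₍₋₁₎ ⊗ a₍₀₎`, is a (coassociative, counital) left coaction. -/
structure IsLeftCoaction (lam : A →ₗ[k] H ⊗[k] A) : Prop where
  coassoc : ∀ a, TensorProduct.assoc k H H A ((Coalgebra.comul (R := k)).rTensor A (lam a)) =
    lam.lTensor H (lam a)
  counit : ∀ a, TensorProduct.lid k A ((Coalgebra.counit (R := k)).rTensor A (lam a)) = a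

/-- The left hand side `∑ f₍₂₎ (a ◁ f₍₁₎)₍₋₁₎ ⊗ (a ◁ f₍₁₎)₍₀₎` of the Yetter–Drinfeld condition. -/
def ydLeft (act : A →ₗ[k] H →ₗ[k] A) (lam : A →ₗ[k] H ⊗[k] A) (a : A) (f : H) : H ⊗[k] A :=
  (LinearMap.mul' k H).rTensor A ((TensorProduct.assoc k H H A).symm
    (TensorProduct.comm k (H ⊗[k] A) H ((lam ∘ₗ act a).rTensor H (Coalgebra.comul f))))

/-- The right hand side `∑ a₍₋₁₎ f₍₁₎ ⊗ (a₍₀₎ ◁ f₍₂₎)` of the Yetter–Drinfeld condition. -/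
def ydRight (act : A →ₗ[k] H →ₗ[k] A) (lam : A →ₗ[k] H ⊗[k] A) (a : A) (f : H) : H ⊗[k] A :=
  TensorProduct.map₂ (LinearMap.mul k H) act (lam a) (Coalgebra.comul f)

/-- The Yetter–Drinfeld braiding `a ⊗ c ↦ ∑ (c ◁ a₍₋₁₎) ⊗ a₍₀₎` of `A` with itself. -/
def ydBraiding (act : A →ₗ[k] H →ₗ[k] A) (lam : A →ₗ[k] H ⊗[k] A) : A ⊗[k] A →ₗ[k] A ⊗[k] A :=
  (TensorProduct.lift act.flip).rTensor A ∘ₗ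
    (TensorProduct.assoc k H A A).symm.toLinearMap ∘ₗ
    (TensorProduct.comm k A A).toLinearMap.lTensor H ∘ₗ
    (TensorProduct.assoc k H A A).toLinearMap ∘ₗ
    lam.rTensor A

end Hopf

/-- `(A, act, lam)` is a braided commutative right-left Yetter–Drinfeld module algebra over the Hopf
algebra `H`. -/
structure IsBraidedCommYDModuleAlgebra {k H A : Type*} [CommRing k] [Ring H] [HopfAlgebra k H]
    [Ring A] [Algebra k A] (act : A →ₗ[k] H →ₗ[k] A) (lam : A →ₗ[k] H ⊗[k] A) : Prop where
  moduleAlgebra : IsRightModuleAlgebra act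
  coaction : IsLeftCoaction lam
  yetterDrinfeld : ∀ a f, ydLeft act lam a f = ydRight act lam a f
  /-- `A` is an `Hᵒᵖ`-comodule algebra: `lam (a c) = ∑ c₍₋₁₎ a₍₋₁₎ ⊗ a₍₀₎ c₍₀₎`. -/
  comodule_mul : ∀ a c, lam (a * c) =
    TensorProduct.map₂ (LinearMap.mul k H).flip (LinearMap.mul k A) (lam a) (lam c)
  comodule_one : lam 1 = 1 ⊗ₜ 1
  /-- The product composed with the braiding is the product: `∑ (a ◁ c₍₋₁₎) c₍₀₎ = c a`. -/
  braidedComm : LinearMap.mul' k A ∘ₗ ydBraiding act lam = LinearMap.mul' k A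

/-! ### The data attached to a left Leibniz algebra with a basis -/

section Data

variable {k h : Type*} [Field k] [AddCommGroup h] [Module k h] [LeftLeibnizAlgebra k h] {n : ℕ}

variable (k h) in
/-- The enveloping algebra `U(h_Lie)`. -/
abbrev ULie : Type _ := UniversalEnvelopingAlgebra k (HLie k h)

variable (k) in
/-- The image `x̃` of `x ∈ h` in `U(h_Lie)`. -/
def tilde (x : h) : ULie k h := UniversalEnvelopingAlgebra.ι k (toHLie k h x)

/-- The structure constants `structConst b i j l = C^l_{ij}`, where `[x_i, x_j] = ∑ C^l_{ij} x_l`. -/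
def structConst (b : Module.Basis (Fin n) k h) (i j l : Fin n) : k :=
  b.repr (lbr k h (b i) (b j)) l

/-- `O(Aut(h))`, presented in the basis `b`. -/
abbrev OAut (b : Module.Basis (Fin n) k h) : Type _ := AutAlg (structConst b)

/-- The generator `G^i_j`: the `(i, j)` matrix entry of an automorphism in the basis `b`. -/
abbrev genG (b : Module.Basis (Fin n) k h) (i j : Fin n) : OAut b := AutAlg.G (structConst b) i j

/-- The generator `Ḡ^i_j`: the `(i, j)` entry of the inverse matrix. -/
abbrev genGbar (b : Module.Basis (Fin n) k h) (i j : Fin n) : OAut b :=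
  AutAlg.Gbar (structConst b) i j

/-- `P` is a Hopf pairing `U(h_Lie) ⊗ O(Aut(h)) → k` with `⟨x̃_l, G^i_j⟩ = C^i_{lj}`. -/
def IsAdPairing (b : Module.Basis (Fin n) k h) (P : ULie k h →ₗ[k] OAut b →ₗ[k] k) : Prop :=
  IsHopfPairing P ∧ ∀ i j l, P (tilde k (b l)) (genG b i j) = structConst b l j i

/-- `lam` is a unital antimultiplicative map to the smash product of `O(Aut(h))` and `U(h_Lie)`
formed with the action `act`, and `lam x̃_j = ∑ Ḡ^i_j ♯ x̃_i`. -/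
structure IsLambda (b : Module.Basis (Fin n) k h) (act : ULie k h →ₗ[k] OAut b →ₗ[k] ULie k h)
    (lam : ULie k h →ₗ[k] OAut b ⊗[k] ULie k h) : Prop where
  map_one : lam 1 = 1 ⊗ₜ 1
  map_mul : ∀ u v, lam (u * v) = smashMul act (lam v) (lam u)
  map_gen : ∀ j, lam (tilde k (b j)) = ∑ i, genGbar b i j ⊗ₜ tilde k (b i)

end Data

end LeibnizYD

end

open LeibnizYD

/-!
Write `U = U(h_Lie)` and `O = O(Aut(h))`.

The pairing evaluates differential operators at the identity. For `x ∈ h` the map `[x, -]` is a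
derivation of `h`, so `1 + ε[x, -]` is an automorphism over the dual numbers, and translating by it
gives a left invariant derivation `D_x` of `O` with `G ↦ G [x, -]` and `Ḡ ↦ - [x, -] Ḡ`
(`AutAlg.leftInvDer`). The map `x ↦ D_x` turns the Leibniz bracket into the commutator, hence kills
the ideal of squares and extends to `U` (`uLieLift`, `diffOp`); put `⟨u, f⟩ = ε(D_u f)`. Its
compatibility with the product of `U` is left invariance `Δ D_u = (id ⊗ D_u) Δ`
(`comul_diffOp`), and its compatibility with the product of `O` says that the multiplication of `O`
is `U`-equivariant (`diffOp_mul'`). A Hopf pairing is determined on the generators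
(`IsAdPairing.unique`), where `⟨x̃, Ḡ⟩ = -⟨x̃, G⟩` because `x̃` is primitive and `G Ḡ = 1`.
That `◁` is a Hopf action and that the smash product is associative is true for every Hopf pairing
(`IsHopfPairing.isRightModuleAlgebra`, `IsRightModuleAlgebra.isAssocUnital_smashMul`).

The map `λ` is first built as a homomorphism `lambdaHom` to the *ordinary* tensor product algebra
`O ⊗ U`; it exists because `Ḡ` is multiplicative too. The key fact is
`IsAdPairing.smashMul_lambdaHom`: for every `s ∈ O ⊗ U`, the smash product `s λ(u)` is the ordinary
product of `λ(u)` and `s`. For generators this is `∑ (x ◁ Ḡ^i_l) x̃_i = x̃_l x̃`, that is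
`x̃ x̃_l - [x, x_l]~ = x̃_l x̃`, and it passes to products by associativity. It shows at once that
`λ` is antimultiplicative for the smash product, that `Im λ` commutes with `1 ♯ U`, and, since `O`
is commutative, that `λ(uv)` is given by the formula for a comodule algebra over `Oᵒᵖ`. As `λ` is
a homomorphism to the ordinary tensor product, coassociativity and counitality need only be checked
on generators. Applying the counit to the commutation relation gives braided commutativity.

In the smash product the Yetter–Drinfeld condition reads `λ(u) f = ∑ f₍₂₎ λ(u ◁ f₍₁₎)`, which
passes to products in `u` (`IsRightModuleAlgebra.yetterDrinfeld_mul`). For `u = x̃_j` it says that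
the right invariant derivation attached to `x_j` is `∑ Ḡ^i_j D_{x_i}`
(`IsAdPairing.lid_rTensor_eq_sum`), an identity of derivations of `O` that is checked on generators.

A change of basis conjugates `G` and `Ḡ` by the transition matrix (`baseChange`); the remaining
invariance statements follow from the uniqueness of the pairing and of `λ`.
-/

/-! ### Hopf pairings, their actions, and smash products -/

namespace LeibnizYD

section Hopf

variable {k B H A : Type*} [CommRing k] [Ring B] [Bialgebra k B] [Ring H] [Bialgebra k H]
  [Ring A] [Algebra k A]

theorem pairingAction_apply (P : B →ₗ[k] H →ₗ[k] k) (b : B) (f : H) :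
    pairingAction P b f = TensorProduct.lid k B ((P.flip f).rTensor B (Coalgebra.comul b)) :=
  rfl

/-- The contraction `x ⊗ y ↦ (f ↦ ⟨x, f⟩ y)`, so that `u ◁ f` is the contraction of `Δ u`. -/
def contractFst (P : B →ₗ[k] H →ₗ[k] k) : B ⊗[k] B →ₗ[k] H →ₗ[k] B :=
  LinearMap.flip
    { toFun := fun f => (TensorProduct.lid k B).toLinearMap ∘ₗ (P.flip f).rTensor B
      map_add' := fun f g => by ext; simp [LinearMap.rTensor_add]
      map_smul' := fun c f => by ext; simp [LinearMap.rTensor_smul] }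

theorem contractFst_tmul (P : B →ₗ[k] H →ₗ[k] k) (x y : B) (f : H) :
    contractFst P (x ⊗ₜ y) f = P x f • y := by
  simp [contractFst]

theorem pairingAction_eq_contractFst (P : B →ₗ[k] H →ₗ[k] k) (b : B) :
    pairingAction P b = contractFst P (Coalgebra.comul b) :=
  rfl

theorem IsHopfPairing.isRightModuleAlgebra {P : B →ₗ[k] H →ₗ[k] k} (hP : IsHopfPairing P) :
    IsRightModuleAlgebra (pairingAction P) where
  act_one b := by
    have : P.flip 1 = Coalgebra.counit := LinearMap.ext hP.one_right
    rw [pairingAction_apply, this, Coalgebra.rTensor_counit_comul]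
    simp
  act_mul b f g := by
    -- Both sides contract the first two legs of the iterated coproduct of `b` with `f ⊗ g`.
    let Φ : (B ⊗[k] B) ⊗[k] B →ₗ[k] B :=
      (TensorProduct.lid k B).toLinearMap ∘ₗ ((pairing₂ P).flip (f ⊗ₜ g)).rTensor B
    have h1 : ∀ z : B ⊗[k] B, contractFst P z (f * g) =
        Φ ((Coalgebra.comul (R := k)).rTensor B z) := by
      intro z
      induction z with
      | zero => simp
      | add x y hx hy => simp only [map_add, LinearMap.add_apply, hx, hy]
      | tmul x y => simp [Φ, contractFst_tmul, hP.comul_left]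
    have h2 : ∀ z : B ⊗[k] B, pairingAction P (contractFst P z f) g =
        Φ ((TensorProduct.assoc k B B B).symm ((Coalgebra.comul (R := k)).lTensor B z)) := by
      intro z
      induction z with
      | zero => simp
      | add x y hx hy => simp only [map_add, hx, hy, LinearMap.add_apply]
      | tmul x y =>
        simp only [contractFst_tmul, map_smul, LinearMap.smul_apply, LinearMap.lTensor_tmul,
          pairingAction_eq_contractFst]
        induction Coalgebra.comul (R := k) y with
        | zero => simp
        | add s t hs ht =>
          simp only [map_add, smul_add, LinearMap.add_apply, TensorProduct.tmul_add, hs, ht]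
        | tmul s t => simp [Φ, pairing₂_tmul, contractFst_tmul, smul_smul]
    rw [pairingAction_eq_contractFst P b, h1, h2, ← Coalgebra.coassoc_apply,
      LinearEquiv.symm_apply_apply]
  mul_act a c f := by
    simp only [pairingAction_eq_contractFst, Bialgebra.comul_mul]
    generalize Coalgebra.comul (R := k) a = s
    generalize Coalgebra.comul (R := k) c = t
    induction s with
    | zero => simp
    | add x y hx hy =>
      simp only [add_mul, map_add, LinearMap.add_apply, hx, hy, TensorProduct.map_add_left]
    | tmul x x' =>
    induction t with
    | zero => simp
    | add x y hx hy =>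
      simp only [mul_add, map_add, LinearMap.add_apply, hx, hy, TensorProduct.map_add_right]
    | tmul y y' =>
      rw [Algebra.TensorProduct.tmul_mul_tmul, contractFst_tmul, ← hP.comul_right]
      induction Coalgebra.comul (R := k) f with
      | zero => simp
      | add s t hs ht => simp only [map_add, add_smul, hs, ht]
      | tmul s t => simp [pairing₂_tmul, contractFst_tmul, smul_smul, mul_comm]
  one_act f := by
    rw [pairingAction_eq_contractFst, Bialgebra.comul_one, Algebra.TensorProduct.one_def,
      contractFst_tmul, hP.one_left]

theorem IsHopfPairing.pairingAction_primitive {P : B →ₗ[k] H →ₗ[k] k} (hP : IsHopfPairing P)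
    {x : B} (hx : Coalgebra.comul (R := k) x = x ⊗ₜ 1 + 1 ⊗ₜ x) (f : H) :
    pairingAction P x f = P x f • 1 + Coalgebra.counit (R := k) f • x := by
  rw [pairingAction_eq_contractFst, hx, map_add, LinearMap.add_apply, contractFst_tmul,
    contractFst_tmul, hP.one_left]

theorem IsHopfPairing.mul_primitive {P : B →ₗ[k] H →ₗ[k] k} (hP : IsHopfPairing P)
    {x : B} (hx : Coalgebra.comul (R := k) x = x ⊗ₜ 1 + 1 ⊗ₜ x) (f g : H) :
    P x (f * g) = P x f * Coalgebra.counit g + Coalgebra.counit f * P x g := by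
  rw [← hP.comul_left, hx, map_add, LinearMap.add_apply, pairing₂_tmul, pairing₂_tmul,
    hP.one_left, hP.one_left]

theorem IsHopfPairing.algebraMap_primitive {P : B →ₗ[k] H →ₗ[k] k} (hP : IsHopfPairing P)
    {x : B} (hx : Coalgebra.counit (R := k) x = 0) (c : k) : P x (algebraMap k H c) = 0 := by
  rw [Algebra.algebraMap_eq_smul_one, map_smul, hP.one_right, hx, smul_zero]

/-- Hopf pairings pull back along bialgebra maps. -/
theorem IsHopfPairing.comp {H' : Type*} [Ring H'] [Bialgebra k H'] {P : B →ₗ[k] H →ₗ[k] k}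
    (hP : IsHopfPairing P) (θ : H' →ₐc[k] H) :
    IsHopfPairing (P.compl₂ (θ : H' →ₗ[k] H)) := by
  have key : ∀ (s : B ⊗[k] B) (t : H' ⊗[k] H'), pairing₂ (P.compl₂ (θ : H' →ₗ[k] H)) s t =
      pairing₂ P s (TensorProduct.map (θ : H' →ₗ[k] H) (θ : H' →ₗ[k] H) t) := by
    intro s t
    induction s with
    | zero => simp
    | add x y hx hy => simp only [map_add, LinearMap.add_apply, hx, hy]
    | tmul x y =>
      induction t with
      | zero => simp
      | add x y hx hy => simp only [map_add, hx, hy]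
      | tmul f g => simp [pairing₂_tmul]
  constructor
  · intro b f g
    rw [key, TensorProduct.map_tmul, hP.comul_left]
    simp
  · intro b
    simp [hP.one_right]
  · intro b c f
    rw [key]
    have := CoalgHomClass.map_comp_comul_apply θ f
    rw [LinearMap.compl₂_apply, ← hP.comul_right]
    exact congrArg _ this
  · intro f
    have := CoalgHomClass.counit_comp_apply θ f
    rw [LinearMap.compl₂_apply, hP.one_left]
    exact this

theorem smashMul_one_tmul {act : A →ₗ[k] H →ₗ[k] A} (f : H) (a v : A) :
    smashMul act (f ⊗ₜ a) (1 ⊗ₜ v) = f ⊗ₜ (act a 1 * v) := by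
  rw [smashMul_tmul, Bialgebra.comul_one, Algebra.TensorProduct.one_def]
  simp

namespace IsRightModuleAlgebra

variable {act : A →ₗ[k] H →ₗ[k] A}

/-- Left multiplication by `f ♯ 1` is multiplication in the first tensor factor. -/
theorem smashMul_tmul_one (hact : IsRightModuleAlgebra act) (f : H) (t : H ⊗[k] A) :
    smashMul act (f ⊗ₜ 1) t = (f ⊗ₜ 1) * t := by
  induction t with
  | zero => simp
  | add x x' hx hx' => simp only [map_add, mul_add, hx, hx']
  | tmul g c =>
    have h1 : ∀ w : H ⊗[k] H,
        TensorProduct.map (LinearMap.mulLeft k f) (LinearMap.mulRight k c ∘ₗ act 1) w =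
        (f ⊗ₜ[k] c) * ((TensorProduct.rid k H
          ((Coalgebra.counit (R := k) (A := H)).lTensor H w)) ⊗ₜ[k] 1) := by
      intro w
      induction w with
      | zero => simp
      | add x x' hx hx' => simp only [map_add, TensorProduct.add_tmul, mul_add, hx, hx']
      | tmul x y => simp [hact.one_act, TensorProduct.smul_tmul]
    rw [smashMul_tmul, h1, Coalgebra.lTensor_counit_comul]
    simp

/-- Right multiplication by `1 ♯ v` is multiplication in the second tensor factor. -/
theorem smashMul_one_tmul (hact : IsRightModuleAlgebra act) (s : H ⊗[k] A) (v : A) :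
    smashMul act s (1 ⊗ₜ v) = s * (1 ⊗ₜ v) := by
  induction s with
  | zero => simp
  | add x x' hx hx' => simp only [map_add, LinearMap.add_apply, add_mul, hx, hx']
  | tmul f a => simp [LeibnizYD.smashMul_one_tmul, hact.act_one]

theorem isAssocUnital_smashMul (hact : IsRightModuleAlgebra act) :
    IsAssocUnital (smashMul act) (1 ⊗ₜ[k] 1) where
  assoc x y z := by
    induction x with
    | zero => simp
    | add x x' hx hx' => simp only [map_add, LinearMap.add_apply, hx, hx']
    | tmul f a =>
    induction y with
    | zero => simp
    | add x x' hx hx' => simp only [map_add, LinearMap.add_apply, hx, hx']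
    | tmul g b =>
    induction z with
    | zero => simp
    | add x x' hx hx' => simp only [map_add, hx, hx']
    | tmul h c =>
    -- Both sides are `∑ f g₍₁₎ h₍₁₎ ♯ (a ◁ g₍₂₎ h₍₂₎) (b ◁ h₍₃₎) c`.
    let Ψ (g₁ g₂ : H) : H ⊗[k] (H ⊗[k] H) →ₗ[k] H ⊗[k] A :=
      TensorProduct.map (LinearMap.mulLeft k (f * g₁)) (LinearMap.mulRight k c ∘ₗ
        LinearMap.mul' k A ∘ₗ TensorProduct.map (act (act a g₂)) (act b))
    let r := Coalgebra.Repr.arbitrary k g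
    have hr := r.eq
    have h1 : ∀ g₁ g₂ : H, smashMul act ((f * g₁) ⊗ₜ (act a g₂ * b)) (h ⊗ₜ c) =
        Ψ g₁ g₂ ((Coalgebra.comul (R := k)).lTensor H (Coalgebra.comul h)) := by
      intro g₁ g₂
      rw [smashMul_tmul]
      induction Coalgebra.comul (R := k) h with
      | zero => simp
      | add x y hx hy => simp only [map_add, hx, hy]
      | tmul x y => simp [Ψ, hact.mul_act]
    have h2 : ∀ z : H ⊗[k] H, smashMul act (f ⊗ₜ a)
          (TensorProduct.map (LinearMap.mulLeft k g) (LinearMap.mulRight k c ∘ₗ act b) z) =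
        ∑ i ∈ r.index, Ψ (r.left i) (r.right i)
          (TensorProduct.assoc k H H H ((Coalgebra.comul (R := k)).rTensor H z)) := by
      intro z
      induction z with
      | zero => simp
      | add x y hx hy => simp only [map_add, hx, hy, Finset.sum_add_distrib]
      | tmul x y =>
        simp only [TensorProduct.map_tmul, LinearMap.mulLeft_apply, smashMul_tmul,
          Bialgebra.comul_mul, ← hr, Finset.sum_mul, map_sum, LinearMap.rTensor_tmul]
        refine Finset.sum_congr rfl fun i _ => ?_
        induction Coalgebra.comul (R := k) x with
        | zero => simp
        | add s t hs ht => simp only [mul_add, map_add, TensorProduct.add_tmul, hs, ht]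
        | tmul s t => simp [Ψ, hact.act_mul, mul_assoc]
    rw [smashMul_tmul act g h b c, h2, Coalgebra.coassoc_apply, smashMul_tmul, ← hr]
    simp only [map_sum, LinearMap.sum_apply]
    exact Finset.sum_congr rfl fun i _ => h1 _ _
  one_mul x := by
    rw [hact.smashMul_tmul_one, ← Algebra.TensorProduct.one_def, one_mul]
  mul_one x := by
    rw [hact.smashMul_one_tmul, ← Algebra.TensorProduct.one_def, mul_one]

end IsRightModuleAlgebra

end Hopf

end LeibnizYD

/-! ### The Yetter–Drinfeld condition and braided commutativity -/

namespace LeibnizYD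

section YetterDrinfeld

variable {k H A : Type*} [CommRing k] [Ring H] [Bialgebra k H] [Ring A] [Algebra k A]
  {act : A →ₗ[k] H →ₗ[k] A} {lam : A →ₗ[k] H ⊗[k] A}

/-- The right hand side of the Yetter–Drinfeld condition is the smash product
`lam(a) (f ♯ 1)`. -/
theorem ydRight_eq_smashMul (a : A) (f : H) :
    ydRight act lam a f = smashMul act (lam a) (f ⊗ₜ 1) := by
  rw [ydRight]
  induction lam a with
  | zero => simp
  | add x y hx hy => simp only [map_add, LinearMap.add_apply, hx, hy]
  | tmul x y =>
    rw [smashMul_tmul]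
    induction Coalgebra.comul (R := k) f with
    | zero => simp
    | add x y hx hy => simp only [map_add, hx, hy]
    | tmul x y => simp

/-- The map `x ⊗ y ↦ y · lam(a ◁ x)`, so that the left hand side of the Yetter–Drinfeld condition
is its value at `Δ f`. -/
def ydLeftMap (act : A →ₗ[k] H →ₗ[k] A) (lam : A →ₗ[k] H ⊗[k] A) (a : A) :
    H ⊗[k] H →ₗ[k] H ⊗[k] A :=
  (LinearMap.mul' k H).rTensor A ∘ₗ (TensorProduct.assoc k H H A).symm.toLinearMap ∘ₗ
    (TensorProduct.comm k (H ⊗[k] A) H).toLinearMap ∘ₗ (lam ∘ₗ act a).rTensor H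

theorem ydLeft_eq_ydLeftMap (a : A) (f : H) :
    ydLeft act lam a f = ydLeftMap act lam a (Coalgebra.comul f) :=
  rfl

theorem ydLeftMap_tmul (a : A) (x y : H) :
    ydLeftMap act lam a (x ⊗ₜ y) = (y ⊗ₜ 1) * lam (act a x) := by
  simp only [ydLeftMap, LinearMap.comp_apply, LinearMap.rTensor_tmul, LinearEquiv.coe_coe,
    TensorProduct.comm_tmul]
  induction lam (act a x) with
  | zero => simp
  | add x y hx hy => simp only [map_add, TensorProduct.tmul_add, hx, hy, mul_add]
  | tmul x y => simp

/-- In the smash product the Yetter–Drinfeld condition reads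
`lam(a) (f ♯ 1) = ∑ (f₍₂₎ ♯ 1) lam(a ◁ f₍₁₎)`. When `lam` is antimultiplicative this passes to
products: `lam(c) lam(a) f = lam(c) f₍₂₎ lam(a ◁ f₍₁₎) = f₍₃₎ lam(c ◁ f₍₂₎) lam(a ◁ f₍₁₎)`. -/
theorem IsRightModuleAlgebra.yetterDrinfeld_mul (hact : IsRightModuleAlgebra act)
    (hlam : ∀ a c, lam (a * c) = smashMul act (lam c) (lam a)) {a c : A}
    (ha : ∀ f, ydLeft act lam a f = ydRight act lam a f)
    (hc : ∀ f, ydLeft act lam c f = ydRight act lam c f) (f : H) :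
    ydLeft act lam (a * c) f = ydRight act lam (a * c) f := by
  have hassoc := hact.isAssocUnital_smashMul.assoc
  let Φ : H ⊗[k] (H ⊗[k] H) →ₗ[k] H ⊗[k] A :=
    TensorProduct.lift (LinearMap.mk₂ k
      (fun x w => smashMul act (ydLeftMap act lam c w) (lam (act a x)))
      (by simp) (by simp) (by simp) (by simp))
  have h1 : ∀ z : H ⊗[k] H, smashMul act (lam c) (ydLeftMap act lam a z) =
      Φ ((Coalgebra.comul (R := k)).lTensor H z) := by
    intro z
    induction z with
    | zero => simp
    | add x y hx hy => simp only [map_add, hx, hy]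
    | tmul x y =>
      rw [ydLeftMap_tmul, ← hact.smashMul_tmul_one, ← hassoc, ← ydRight_eq_smashMul, ← hc,
        ydLeft_eq_ydLeftMap]
      simp [Φ]
  have h2 : ∀ z : H ⊗[k] H, ydLeftMap act lam (a * c) z =
      Φ (TensorProduct.assoc k H H H ((Coalgebra.comul (R := k)).rTensor H z)) := by
    intro z
    induction z with
    | zero => simp
    | add x y hx hy => simp only [map_add, hx, hy]
    | tmul x y =>
      rw [ydLeftMap_tmul, hact.mul_act, LinearMap.rTensor_tmul]
      induction Coalgebra.comul (R := k) x with
      | zero => simp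
      | add s t hs ht => simp only [mul_add, map_add, TensorProduct.add_tmul, hs, ht]
      | tmul s t =>
        rw [TensorProduct.map_tmul, LinearMap.mul'_apply, hlam, ← hact.smashMul_tmul_one,
          ← hassoc, hact.smashMul_tmul_one, ← ydLeftMap_tmul]
        simp [Φ]
  rw [ydRight_eq_smashMul, hlam, hassoc, ← ydRight_eq_smashMul, ← ha, ydLeft_eq_ydLeftMap,
    ydLeft_eq_ydLeftMap, h1, h2, Coalgebra.coassoc_apply]

/-- If `lam(a)` commutes with `1 ♯ c` in the smash product, applying the counit to both orders of
the product gives braided commutativity for the pair `(a, c)`. -/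
theorem IsRightModuleAlgebra.mul'_ydBraiding_tmul (hact : IsRightModuleAlgebra act)
    (hlam : IsLeftCoaction lam) {a c : A}
    (h : smashMul act (lam a) (1 ⊗ₜ[k] c) = smashMul act (1 ⊗ₜ[k] c) (lam a)) :
    LinearMap.mul' k A (ydBraiding act lam (a ⊗ₜ c)) = a * c := by
  let e : H ⊗[k] A →ₗ[k] A :=
    (TensorProduct.lid k A).toLinearMap ∘ₗ (Coalgebra.counit (R := k)).rTensor A
  have h1 : ∀ s : H ⊗[k] A, e (smashMul act s (1 ⊗ₜ[k] c)) = e s * c := by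
    intro s
    rw [hact.smashMul_one_tmul]
    induction s with
    | zero => simp
    | add x y hx hy => simp only [map_add, add_mul, hx, hy]
    | tmul x y => simp [e]
  have h2 : ∀ s : H ⊗[k] A, e (smashMul act (1 ⊗ₜ[k] c) s) = LinearMap.mul' k A
      ((TensorProduct.lift act.flip).rTensor A ((TensorProduct.assoc k H A A).symm
        ((TensorProduct.comm k A A).toLinearMap.lTensor H
          (TensorProduct.assoc k H A A (s ⊗ₜ c))))) := by
    intro s
    induction s with
    | zero => simp
    | add x y hx hy => simp only [map_add, TensorProduct.add_tmul, hx, hy]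
    | tmul x y =>
      have h3 : ∀ w : H ⊗[k] H, e (TensorProduct.map (LinearMap.mulLeft k 1)
          (LinearMap.mulRight k y ∘ₗ act c) w) = act c (TensorProduct.lid k H
            ((Coalgebra.counit (R := k)).rTensor H w)) * y := by
        intro w
        induction w with
        | zero => simp
        | add x y hx hy => simp only [map_add, add_mul, hx, hy]
        | tmul x y => simp [e]
      rw [smashMul_tmul, h3, Coalgebra.rTensor_counit_comul]
      simp
  have h4 := h2 (lam a)
  rw [← h, h1] at h4
  have h5 : e (lam a) = a := hlam.counit a
  rw [h5] at h4
  exact h4.symm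

end YetterDrinfeld

section Enveloping

variable {k g : Type*} [CommRing k] [LieRing g] [LieAlgebra k g]

attribute [local instance] LieRing.ofAssociativeRing

@[elab_as_elim]
theorem enveloping_induction {p : UniversalEnvelopingAlgebra k g → Prop}
    (algebraMap : ∀ c, p (algebraMap k _ c)) (ι : ∀ x, p (UniversalEnvelopingAlgebra.ι k x))
    (mul : ∀ u v, p u → p v → p (u * v)) (add : ∀ u v, p u → p v → p (u + v))
    (u : UniversalEnvelopingAlgebra k g) : p u := by
  let S : Subalgebra k (UniversalEnvelopingAlgebra k g) :=
    { carrier := {u | p u}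
      mul_mem' := mul _ _
      add_mem' := add _ _
      algebraMap_mem' := algebraMap }
  let f : g →ₗ⁅k⁆ S :=
    { toFun := fun x => ⟨UniversalEnvelopingAlgebra.ι k x, ι x⟩
      map_add' := fun x y => Subtype.ext (map_add _ x y)
      map_smul' := fun c x => Subtype.ext (map_smul _ c x)
      map_lie' := fun {x y} => Subtype.ext (LieHom.map_lie _ x y) }
  have h : S.val.comp (UniversalEnvelopingAlgebra.lift k f) = AlgHom.id k _ := by
    apply enveloping_algHom_ext
    intro x
    rw [AlgHom.comp_apply, UniversalEnvelopingAlgebra.lift_ι_apply]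
    rfl
  have := (UniversalEnvelopingAlgebra.lift k f u).2
  rw [show ((UniversalEnvelopingAlgebra.lift k f u : S) : UniversalEnvelopingAlgebra k g) = u from
    DFunLike.congr_fun h u] at this
  exact this

end Enveloping

section Leibniz

variable {k h : Type*} [Field k] [AddCommGroup h] [Module k h] [LeftLeibnizAlgebra k h]

theorem comul_tilde (x : h) : Coalgebra.comul (R := k) (tilde k x) =
    tilde k x ⊗ₜ[k] 1 + 1 ⊗ₜ[k] tilde k x :=
  comul_ι k _ _

theorem counit_tilde (x : h) : Coalgebra.counit (R := k) (tilde k x) = 0 :=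
  counit_ι k _ _

theorem tilde_add (x y : h) : tilde k (x + y) = tilde k x + tilde k y := by
  simp only [tilde, map_add]

theorem tilde_smul (c : k) (x : h) : tilde k (c • x) = c • tilde k x := by
  simp only [tilde, map_smul]

/-- The map `x ↦ x̃`, bundled as a linear map. -/
def tildeLin (k h : Type*) [Field k] [AddCommGroup h] [Module k h] [LeftLeibnizAlgebra k h] :
    h →ₗ[k] ULie k h where
  toFun := tilde k
  map_add' := tilde_add
  map_smul' := tilde_smul

@[simp] theorem tildeLin_apply (x : h) : tildeLin k h x = tilde k x := rfl

theorem tilde_lbr (x y : h) :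
    tilde k (lbr k h x y) = tilde k x * tilde k y - tilde k y * tilde k x := by
  simp only [tilde, toHLie_lbr]
  let _ := LieRing.ofAssociativeRing (A := ULie k h)
  exact LieHom.map_lie (UniversalEnvelopingAlgebra.ι k) _ _

/-- An induction principle for `U(h_Lie)` with generators the images of elements of `h`. -/
@[elab_as_elim]
theorem uLie_induction {p : ULie k h → Prop}
    (algebraMap : ∀ c, p (algebraMap k _ c)) (tilde : ∀ x : h, p (tilde k x))
    (mul : ∀ u v, p u → p v → p (u * v)) (add : ∀ u v, p u → p v → p (u + v))
    (u : ULie k h) : p u := by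
  refine enveloping_induction algebraMap (fun x => ?_) mul add u
  obtain ⟨x, rfl⟩ := toHLie_surjective k h x
  exact tilde x

/-- The universal property of `U(h_Lie)` in terms of `h`: a linear map to an associative algebra
that turns the Leibniz bracket into the commutator kills the ideal of squares, hence extends to
`U(h_Lie)`. -/
def uLieLift {A : Type*} [Ring A] [Algebra k A] (f : h →ₗ[k] A)
    (hf : ∀ x y, f (lbr k h x y) = f x * f y - f y * f x) : ULie k h →ₐ[k] A :=
  letI := LieRing.ofAssociativeRing (A := A)
  have hker : squaresIdeal k h ≤ LinearMap.ker f := sInf_le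
    ⟨fun x => by simp [hf], fun a x hx => by
      rw [LinearMap.mem_ker] at hx
      simp [hf, hx]⟩
  UniversalEnvelopingAlgebra.lift k
    { toLinearMap := (squaresIdeal k h).liftQ f hker
      map_lie' := by
        intro x y
        obtain ⟨x, rfl⟩ := toHLie_surjective k h x
        obtain ⟨y, rfl⟩ := toHLie_surjective k h y
        exact hf x y }

@[simp] theorem uLieLift_tilde {A : Type*} [Ring A] [Algebra k A] (f : h →ₗ[k] A)
    (hf : ∀ x y, f (lbr k h x y) = f x * f y - f y * f x) (x : h) :
    uLieLift f hf (tilde k x) = f x :=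
  let _ := LieRing.ofAssociativeRing (A := A)
  UniversalEnvelopingAlgebra.lift_ι_apply _ _ _

end Leibniz

end LeibnizYD

/-! ### Left invariant derivations of the automorphism Hopf algebra -/

namespace LeibnizYD

namespace AutAlg

variable {k : Type*} [CommRing k] {n : ℕ} {C : Fin n → Fin n → Fin n → k}

@[elab_as_elim]
theorem induction {p : AutAlg C → Prop} (algebraMap : ∀ c, p (algebraMap k _ c))
    (G : ∀ i j, p (G C i j)) (Gbar : ∀ i j, p (Gbar C i j))
    (mul : ∀ f g, p f → p g → p (f * g)) (add : ∀ f g, p f → p g → p (f + g))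
    (f : AutAlg C) : p f := by
  obtain ⟨q, rfl⟩ : ∃ q, mk C q = f := Ideal.Quotient.mk_surjective f
  induction q using MvPolynomial.induction_on with
  | C c => rw [mk_C]; exact algebraMap c
  | add q r hq hr => rw [map_add]; exact add _ _ hq hr
  | mul_X q i hq =>
    rw [map_mul]
    refine mul _ _ hq ?_
    rcases i with ⟨i, j⟩ | ⟨i, j⟩
    · exact G i j
    · exact Gbar i j

theorem derivation_ext {M : Type*} [AddCommGroup M] [Module k M] [Module (AutAlg C) M]
    {D E : Derivation k (AutAlg C) M} (h1 : ∀ i j, D (G C i j) = E (G C i j))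
    (h2 : ∀ i j, D (Gbar C i j) = E (Gbar C i j)) : D = E := by
  ext f
  induction f using AutAlg.induction with
  | algebraMap c => simp
  | G i j => exact h1 i j
  | Gbar i j => exact h2 i j
  | mul f g hf hg => simp [hf, hg]
  | add f g hf hg => simp [hf, hg]

@[simp] theorem comul_G (i j : Fin n) : Coalgebra.comul (R := k) (G C i j) =
    ∑ l, G C i l ⊗ₜ[k] G C l j :=
  comulHom_G C i j

@[simp] theorem comul_Gbar (i j : Fin n) : Coalgebra.comul (R := k) (Gbar C i j) =
    ∑ l, Gbar C l j ⊗ₜ[k] Gbar C i l :=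
  comulHom_Gbar C i j

@[simp] theorem counit_G (i j : Fin n) : Coalgebra.counit (R := k) (G C i j) =
    if i = j then 1 else 0 :=
  counitHom_G C i j

@[simp] theorem counit_Gbar (i j : Fin n) : Coalgebra.counit (R := k) (Gbar C i j) =
    if i = j then 1 else 0 :=
  counitHom_Gbar C i j

/-- The matrix `L` is a derivation of the algebra with structure constants `C`. -/
def IsDer (C : Fin n → Fin n → Fin n → k) (L : Matrix (Fin n) (Fin n) k) : Prop :=
  ∀ i j p, ∑ l, C l j p * L l i + ∑ m, C i m p * L m j = ∑ r, L p r * C i j r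

variable {L : Matrix (Fin n) (Fin n) k}

section DualNumber

variable (L) (R : Type*) [CommRing R] [Algebra k R]

/-- The matrix `εL` over the dual numbers. -/
def epsMat : Matrix (Fin n) (Fin n) (DualNumber R) :=
  L.map fun c => TrivSqZeroExt.inr (algebraMap k R c)

theorem fst_epsMat (i j : Fin n) : (epsMat L R i j).fst = 0 := rfl

theorem snd_epsMat (i j : Fin n) : (epsMat L R i j).snd = algebraMap k R (L i j) := rfl

theorem fst_one_add_epsMat (i j : Fin n) :
    ((1 + epsMat L R) i j).fst = algebraMap k R (if i = j then 1 else 0) := by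
  rw [Matrix.add_apply, Matrix.one_apply, TrivSqZeroExt.fst_add, fst_epsMat]
  split_ifs <;> simp

theorem snd_one_add_epsMat (i j : Fin n) :
    ((1 + epsMat L R) i j).snd = algebraMap k R (L i j) := by
  rw [Matrix.add_apply, Matrix.one_apply, TrivSqZeroExt.snd_add, snd_epsMat]
  split_ifs <;> simp

theorem epsMat_mul_self : epsMat L R * epsMat L R = 0 := by
  ext i j
  · simp [Matrix.mul_apply, TrivSqZeroExt.fst_sum, fst_epsMat]
  · simp [Matrix.mul_apply, TrivSqZeroExt.snd_sum, fst_epsMat]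

variable {L} in
/-- A derivation `L` gives the infinitesimal automorphism `1 + εL` over the dual numbers. -/
theorem IsDer.isAutPair (hL : IsDer C L) :
    IsAutPair C (1 + epsMat L R) (1 - epsMat L R) := by
  have h := epsMat_mul_self L R
  have h1 : (1 + epsMat L R) * (1 - epsMat L R) = 1 := by simp [mul_sub, add_mul, h]
  have h2 : (1 - epsMat L R) * (1 + epsMat L R) = 1 := by simp [mul_add, sub_mul, h]
  constructor
  · intro i j
    rw [← Matrix.mul_apply, ← Matrix.one_apply, h1]
  · intro i j
    rw [← Matrix.mul_apply, ← Matrix.one_apply, h2]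
  · intro i j p
    ext
    · simp only [TrivSqZeroExt.fst_sum, TrivSqZeroExt.fst_mul, fst_one_add_epsMat,
        TrivSqZeroExt.algebraMap_eq_inl', TrivSqZeroExt.fst_inl, ← map_mul, ← map_sum]
      simp
    · simp only [TrivSqZeroExt.snd_sum, TrivSqZeroExt.snd_mul, TrivSqZeroExt.fst_mul,
        fst_one_add_epsMat, snd_one_add_epsMat, TrivSqZeroExt.algebraMap_eq_inl',
        TrivSqZeroExt.fst_inl, TrivSqZeroExt.snd_inl, op_smul_eq_smul, smul_eq_mul, mul_zero,
        smul_zero, add_zero, zero_add, ← map_mul, ← map_sum, ← map_add]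
      congr 1
      have := hL i j p
      simp only [mul_add, Finset.sum_add_distrib]
      simpa [mul_comm, add_comm] using this

theorem map_inl_mul_one_add_epsMat (X : Matrix (Fin n) (Fin n) R) (i j : Fin n) :
    (X.map (TrivSqZeroExt.inlAlgHom k R R) * (1 + epsMat L R)) i j =
      TrivSqZeroExt.inl (X i j) + TrivSqZeroExt.inr (∑ l, L l j • X i l) := by
  rw [mul_add, mul_one, Matrix.add_apply, Matrix.mul_apply]
  ext
  · simp [TrivSqZeroExt.fst_sum, fst_epsMat, -DualNumber.inr_eq_smul_eps]
  · simp [TrivSqZeroExt.snd_sum, fst_epsMat, snd_epsMat, Algebra.smul_def, mul_comm,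
      -DualNumber.inr_eq_smul_eps]

theorem one_sub_epsMat_mul_map_inl (X : Matrix (Fin n) (Fin n) R) (i j : Fin n) :
    ((1 - epsMat L R) * X.map (TrivSqZeroExt.inlAlgHom k R R)) i j =
      TrivSqZeroExt.inl (X i j) + TrivSqZeroExt.inr (- ∑ l, L i l • X l j) := by
  rw [sub_mul, one_mul, Matrix.sub_apply, Matrix.mul_apply]
  ext
  · simp [TrivSqZeroExt.fst_sum, fst_epsMat, -DualNumber.inr_eq_smul_eps]
  · simp [TrivSqZeroExt.snd_sum, fst_epsMat, snd_epsMat, Algebra.smul_def, mul_comm,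
      -DualNumber.inr_eq_smul_eps]

end DualNumber

/-- The algebra map `G ↦ G (1 + εL)` to the dual numbers over `O(Aut)`. -/
noncomputable def infinitesimalTranslate (hL : IsDer C L) :
    AutAlg C →ₐ[k] DualNumber (AutAlg C) :=
  lift (((isAutPair C).map (TrivSqZeroExt.inlAlgHom k (AutAlg C) (AutAlg C))).mul
    (hL.isAutPair (AutAlg C)))

theorem infinitesimalTranslate_G (hL : IsDer C L) (i j : Fin n) :
    infinitesimalTranslate hL (G C i j) =
      TrivSqZeroExt.inl (G C i j) + TrivSqZeroExt.inr (∑ l, L l j • G C i l) :=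
  (lift_G _ i j).trans (map_inl_mul_one_add_epsMat L (AutAlg C) (Matrix.of (G C)) i j)

theorem infinitesimalTranslate_Gbar (hL : IsDer C L) (i j : Fin n) :
    infinitesimalTranslate hL (Gbar C i j) =
      TrivSqZeroExt.inl (Gbar C i j) + TrivSqZeroExt.inr (- ∑ l, L i l • Gbar C l j) :=
  (lift_Gbar _ i j).trans (one_sub_epsMat_mul_map_inl L (AutAlg C) (Matrix.of (Gbar C)) i j)

theorem fst_infinitesimalTranslate (hL : IsDer C L) (f : AutAlg C) :
    (infinitesimalTranslate hL f).fst = f := by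
  have h : (TrivSqZeroExt.fstHom k (AutAlg C) (AutAlg C)).comp (infinitesimalTranslate hL) =
      AlgHom.id k _ := by
    apply algHom_ext <;> intro i j
    · rw [AlgHom.comp_apply, infinitesimalTranslate_G, TrivSqZeroExt.fstHom_apply,
        TrivSqZeroExt.fst_add, TrivSqZeroExt.fst_inl, TrivSqZeroExt.fst_inr, add_zero]
      rfl
    · rw [AlgHom.comp_apply, infinitesimalTranslate_Gbar, TrivSqZeroExt.fstHom_apply,
        TrivSqZeroExt.fst_add, TrivSqZeroExt.fst_inl, TrivSqZeroExt.fst_inr, add_zero]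
      rfl
  exact DFunLike.congr_fun h f

/-- The left invariant derivation of `O(Aut)` attached to the derivation `L`, with
`G ↦ G L` and `Ḡ ↦ - L Ḡ`: the infinitesimal part of `G ↦ G (1 + εL)`. -/
noncomputable def leftInvDer (hL : IsDer C L) : Derivation k (AutAlg C) (AutAlg C) :=
  Derivation.mk' ((TrivSqZeroExt.sndHom (AutAlg C) (AutAlg C)).restrictScalars k ∘ₗ
      (infinitesimalTranslate hL).toLinearMap) (by
    intro f g
    change (infinitesimalTranslate hL (f * g)).snd = f • (infinitesimalTranslate hL g).snd +
      g • (infinitesimalTranslate hL f).snd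
    rw [map_mul, TrivSqZeroExt.snd_mul, fst_infinitesimalTranslate, fst_infinitesimalTranslate,
      op_smul_eq_smul])

@[simp] theorem leftInvDer_G (hL : IsDer C L) (i j : Fin n) :
    leftInvDer hL (G C i j) = ∑ l, L l j • G C i l := by
  change (infinitesimalTranslate hL (G C i j)).snd = _
  rw [infinitesimalTranslate_G, TrivSqZeroExt.snd_add, TrivSqZeroExt.snd_inl,
    TrivSqZeroExt.snd_inr, zero_add]

@[simp] theorem leftInvDer_Gbar (hL : IsDer C L) (i j : Fin n) :
    leftInvDer hL (Gbar C i j) = - ∑ l, L i l • Gbar C l j := by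
  change (infinitesimalTranslate hL (Gbar C i j)).snd = _
  rw [infinitesimalTranslate_Gbar, TrivSqZeroExt.snd_add, TrivSqZeroExt.snd_inl,
    TrivSqZeroExt.snd_inr, zero_add]

/-- Left invariance: `Δ D = (id ⊗ D) Δ`. -/
theorem comul_leftInvDer (hL : IsDer C L) (f : AutAlg C) :
    Coalgebra.comul (R := k) (leftInvDer hL f) =
      (leftInvDer hL : AutAlg C →ₗ[k] AutAlg C).lTensor (AutAlg C) (Coalgebra.comul f) := by
  have hmul : ∀ s t : AutAlg C ⊗[k] AutAlg C,
      (leftInvDer hL : AutAlg C →ₗ[k] AutAlg C).lTensor (AutAlg C) (s * t) =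
        s * (leftInvDer hL : AutAlg C →ₗ[k] AutAlg C).lTensor (AutAlg C) t +
        t * (leftInvDer hL : AutAlg C →ₗ[k] AutAlg C).lTensor (AutAlg C) s := by
    intro s t
    induction s with
    | zero => simp
    | add x y hx hy => simp only [add_mul, mul_add, map_add, hx, hy]; abel
    | tmul x x' =>
    induction t with
    | zero => simp
    | add x y hx hy => simp only [add_mul, mul_add, map_add, hx, hy]; abel
    | tmul y y' => simp [TensorProduct.tmul_add, mul_comm]
  induction f using AutAlg.induction with
  | algebraMap c =>
    rw [Derivation.map_algebraMap, Bialgebra.comul_algebraMap, map_zero,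
      Algebra.TensorProduct.algebraMap_apply, LinearMap.lTensor_tmul]
    simp
  | G i j =>
    simp only [leftInvDer_G, map_sum, map_smul, comul_G, LinearMap.lTensor_tmul,
      Derivation.coeFn_coe, TensorProduct.tmul_sum, TensorProduct.tmul_smul, Finset.smul_sum]
    exact Finset.sum_comm
  | Gbar i j =>
    simp only [leftInvDer_Gbar, map_sum, map_neg, map_smul, comul_Gbar, LinearMap.lTensor_tmul,
      Derivation.coeFn_coe, TensorProduct.tmul_sum, TensorProduct.tmul_smul, Finset.smul_sum,
      TensorProduct.tmul_neg, Finset.sum_neg_distrib]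
    rw [Finset.sum_comm]
  | mul f g hf hg =>
    rw [Derivation.leibniz, map_add, smul_eq_mul, smul_eq_mul, Bialgebra.comul_mul,
      Bialgebra.comul_mul, hf, hg, Bialgebra.comul_mul, hmul]
  | add f g hf hg => simp only [map_add, hf, hg]

end AutAlg

end LeibnizYD

/-! ### The Hopf pairing by differential operators at the identity -/

namespace LeibnizYD

section Pairing

theorem repr_map_eq_sum {k h : Type*} [CommRing k] [AddCommGroup h] [Module k h] {n : ℕ}
    (b : Module.Basis (Fin n) k h) (f : h →ₗ[k] h) (v : h) (p : Fin n) :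
    b.repr (f v) p = ∑ r, b.repr v r * b.repr (f (b r)) p := by
  conv_lhs => rw [← b.sum_repr v]
  simp only [map_sum, map_smul, Finsupp.coe_finsetSum, Finset.sum_apply, Finsupp.smul_apply,
    smul_eq_mul]

variable {k h : Type*} [Field k] [AddCommGroup h] [Module k h] [LeftLeibnizAlgebra k h] {n : ℕ}
  (b : Module.Basis (Fin n) k h)

/-- The matrix of the left multiplication `[x, -]` in the basis `b`. -/
noncomputable def adMat (x : h) : Matrix (Fin n) (Fin n) k :=
  Matrix.of fun i j => b.repr (lbr k h x (b j)) i

theorem adMat_apply (x : h) (i j : Fin n) : adMat b x i j = b.repr (lbr k h x (b j)) i := rfl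

theorem isDer_adMat (x : h) : AutAlg.IsDer (structConst b) (adMat b x) := by
  intro i j p
  have h1 := repr_map_eq_sum b ((lbr k h).flip (b j)) (lbr k h x (b i)) p
  have h2 := repr_map_eq_sum b (lbr k h (b i)) (lbr k h x (b j)) p
  have h3 := repr_map_eq_sum b (lbr k h x) (lbr k h (b i) (b j)) p
  have h4 := congrArg (fun v => b.repr v p) (LeftLeibnizAlgebra.leibniz (k := k) x (b i) (b j))
  simp only [map_add, Finsupp.add_apply] at h4
  simp only [LinearMap.flip_apply] at h1
  rw [h1, h2, h3] at h4
  simp only [adMat_apply, structConst]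
  simpa [mul_comm] using h4.symm

/-- The left invariant derivation of `O(Aut(h))` given by `[x, -]`. -/
noncomputable def adDer (x : h) : Derivation k (OAut b) (OAut b) :=
  AutAlg.leftInvDer (isDer_adMat b x)

theorem adDer_G (x : h) (i j : Fin n) :
    adDer b x (genG b i j) = ∑ l, b.repr (lbr k h x (b j)) l • genG b i l :=
  AutAlg.leftInvDer_G _ _ _

theorem adDer_Gbar (x : h) (i j : Fin n) :
    adDer b x (genGbar b i j) = -∑ l, b.repr (lbr k h x (b l)) i • genGbar b l j :=
  AutAlg.leftInvDer_Gbar _ _ _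

/-- `x ↦ D_x` as a linear map to the endomorphisms of `O(Aut(h))`. -/
noncomputable def adDerLin : h →ₗ[k] Module.End k (OAut b) where
  toFun x := (adDer b x : OAut b →ₗ[k] OAut b)
  map_add' x y := by
    have : adDer b (x + y) = adDer b x + adDer b y := by
      apply AutAlg.derivation_ext <;> intro i j
      · simp [adDer_G, add_smul, Finset.sum_add_distrib]
      · simp only [adDer_Gbar, Derivation.add_apply, map_add, LinearMap.add_apply,
          Finsupp.add_apply, add_smul, Finset.sum_add_distrib, neg_add]
    rw [this]
    rfl
  map_smul' c x := by
    have : adDer b (c • x) = c • adDer b x := by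
      apply AutAlg.derivation_ext <;> intro i j
      · simp [adDer_G, mul_smul, Finset.smul_sum]
      · simp [adDer_Gbar, mul_smul, Finset.smul_sum]
    rw [this]
    rfl

theorem adDerLin_apply (x : h) (f : OAut b) : adDerLin b x f = adDer b x f := rfl

theorem adDerLin_lbr (x y : h) : adDerLin b (lbr k h x y) =
    adDerLin b x * adDerLin b y - adDerLin b y * adDerLin b x := by
  have hL : ∀ v, lbr k h (lbr k h x y) v =
      lbr k h x (lbr k h y v) - lbr k h y (lbr k h x v) := fun v => by
    rw [LeftLeibnizAlgebra.leibniz (k := k) x y v, add_sub_cancel_right]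
  have : adDer b (lbr k h x y) = ⁅adDer b x, adDer b y⁆ := by
    apply AutAlg.derivation_ext <;> intro i j
    · rw [Derivation.commutator_apply]
      simp only [adDer_G, hL, map_sub, Finsupp.sub_apply, sub_smul, Finset.sum_sub_distrib,
        map_sum, Derivation.map_smul, Finset.smul_sum, smul_smul]
      congr 1
      · rw [Finset.sum_comm]
        refine Finset.sum_congr rfl fun l _ => ?_
        rw [repr_map_eq_sum b (lbr k h x), Finset.sum_smul]
      · rw [Finset.sum_comm]
        refine Finset.sum_congr rfl fun l _ => ?_
        rw [repr_map_eq_sum b (lbr k h y), Finset.sum_smul]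
    · rw [Derivation.commutator_apply]
      simp only [adDer_Gbar, hL, map_sub, Finsupp.sub_apply, sub_smul, Finset.sum_sub_distrib,
        map_sum, map_neg, Derivation.map_smul, Finset.smul_sum, smul_smul, smul_neg,
        Finset.sum_neg_distrib, neg_neg, neg_sub]
      congr 1
      · rw [Finset.sum_comm]
        refine Finset.sum_congr rfl fun l _ => ?_
        rw [repr_map_eq_sum b (lbr k h y), Finset.sum_smul]
        simp only [mul_comm]
      · rw [Finset.sum_comm]
        refine Finset.sum_congr rfl fun l _ => ?_
        rw [repr_map_eq_sum b (lbr k h x), Finset.sum_smul]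
        simp only [mul_comm]
  ext f
  exact DFunLike.congr_fun this f

/-- The action of `U(h_Lie)` on `O(Aut(h))` by left invariant differential operators. -/
noncomputable def diffOp : ULie k h →ₐ[k] Module.End k (OAut b) :=
  uLieLift (adDerLin b) (adDerLin_lbr b)

theorem diffOp_tilde (x : h) (f : OAut b) : diffOp b (tilde k x) f = adDer b x f := by
  rw [diffOp, uLieLift_tilde, adDerLin_apply]

theorem diffOp_algebraMap (c : k) (f : OAut b) :
    diffOp b (algebraMap k _ c) f = c • f := by
  rw [AlgHom.commutes, Module.algebraMap_end_apply]

theorem comul_diffOp (u : ULie k h) (f : OAut b) :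
    Coalgebra.comul (R := k) (diffOp b u f) =
      (diffOp b u).lTensor (OAut b) (Coalgebra.comul f) := by
  induction u using uLie_induction generalizing f with
  | algebraMap c =>
    have : diffOp b (algebraMap k _ c) = c • LinearMap.id :=
      LinearMap.ext fun f => diffOp_algebraMap b c f
    rw [this, LinearMap.lTensor_smul]
    simp
  | tilde x =>
    have : diffOp b (tilde k x) = (adDer b x : OAut b →ₗ[k] OAut b) :=
      LinearMap.ext fun f => diffOp_tilde b x f
    rw [this]
    exact AutAlg.comul_leftInvDer _ f
  | mul u v hu hv =>
    rw [map_mul, Module.End.mul_apply, hu, hv, Module.End.mul_eq_comp, LinearMap.lTensor_comp]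
    rfl
  | add u v hu hv => simp only [map_add, LinearMap.add_apply, LinearMap.lTensor_add, hu, hv]

theorem diffOp_one (u : ULie k h) : diffOp b u 1 = Coalgebra.counit (R := k) u • 1 := by
  induction u using uLie_induction with
  | algebraMap c => rw [diffOp_algebraMap]; simp
  | tilde x => rw [diffOp_tilde, counit_tilde]; simp
  | mul u v hu hv =>
    rw [map_mul, Module.End.mul_apply, hv, map_smul, hu, Bialgebra.counit_mul, smul_smul, mul_comm]
  | add u v hu hv => simp only [map_add, LinearMap.add_apply, hu, hv, add_smul]

/-- `U(h_Lie)` acts on `O(Aut(h)) ⊗ O(Aut(h))` through its coproduct, and the multiplication of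
`O(Aut(h))` is equivariant. -/
theorem diffOp_mul' (u : ULie k h) (z : OAut b ⊗[k] OAut b) :
    diffOp b u (LinearMap.mul' k (OAut b) z) = LinearMap.mul' k (OAut b)
      (Module.endTensorEndAlgHom (R := k) (S := k) (A := k)
        (Algebra.TensorProduct.map (diffOp b) (diffOp b) (Coalgebra.comul u)) z) := by
  induction u using uLie_induction generalizing z with
  | algebraMap c =>
    rw [Bialgebra.comul_algebraMap, AlgHom.commutes, AlgHom.commutes, AlgHom.commutes,
      Module.algebraMap_end_apply, Module.algebraMap_end_apply, map_smul]
  | tilde x =>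
    rw [comul_tilde]
    induction z with
    | zero => simp
    | add y z hy hz => simp only [map_add, LinearMap.add_apply] at hy hz ⊢; rw [hy, hz]
    | tmul f g =>
      simp [Module.endTensorEndAlgHom_apply, diffOp_tilde, mul_comm, add_comm]
  | mul u v hu hv =>
    rw [map_mul, Module.End.mul_apply, hv, hu, Bialgebra.comul_mul, map_mul, map_mul,
      Module.End.mul_apply]
  | add u v hu hv => simp only [map_add, LinearMap.add_apply, hu, hv]

/-- The pairing `⟨u, f⟩ = ε(D_u f)`: a differential operator evaluated at the identity. -/
noncomputable def adPairing : ULie k h →ₗ[k] OAut b →ₗ[k] k :=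
  (diffOp b).toLinearMap.compr₂ (Coalgebra.counit (R := k))

theorem adPairing_apply (u : ULie k h) (f : OAut b) :
    adPairing b u f = Coalgebra.counit (R := k) (diffOp b u f) := rfl

theorem isHopfPairing_adPairing : IsHopfPairing (adPairing b) where
  comul_left u f g := by
    rw [adPairing_apply, ← LinearMap.mul'_apply (R := k), diffOp_mul']
    induction Coalgebra.comul (R := k) u with
    | zero => simp
    | add x y hx hy => simp only [map_add, LinearMap.add_apply, hx, hy]
    | tmul x y =>
      simp [pairing₂_tmul, Module.endTensorEndAlgHom_apply, adPairing_apply]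
  one_right u := by
    rw [adPairing_apply]
    rw [diffOp_one]
    simp
  comul_right u v f := by
    have h1 : diffOp b v f = TensorProduct.rid k _
        ((adPairing b v).lTensor (OAut b) (Coalgebra.comul f)) := by
      have : adPairing b v = (Coalgebra.counit (R := k)) ∘ₗ diffOp b v := rfl
      rw [this, LinearMap.lTensor_comp, LinearMap.comp_apply, ← comul_diffOp,
        Coalgebra.lTensor_counit_comul]
      simp
    rw [adPairing_apply, map_mul, Module.End.mul_apply, h1]
    induction Coalgebra.comul (R := k) f with
    | zero => simp
    | add x y hx hy => simp only [map_add, hx, hy]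
    | tmul x y => simp [pairing₂_tmul, adPairing_apply, mul_comm]
  one_left f := by rw [adPairing_apply, map_one, Module.End.one_apply]

theorem isAdPairing_adPairing : IsAdPairing b (adPairing b) := by
  refine ⟨isHopfPairing_adPairing b, fun i j l => ?_⟩
  rw [adPairing_apply, diffOp_tilde, adDer_G]
  simp [structConst]

end Pairing

end LeibnizYD

/-! ### Values and uniqueness of the pairing, left and right invariant derivations -/

namespace LeibnizYD

section PrimitiveDerivation

variable {k B H : Type*} [CommRing k] [Ring B] [Bialgebra k B] [CommRing H] [Bialgebra k H]

/-- A primitive element acts on `H` by the derivation `f ↦ ∑ ⟨x, f₍₁₎⟩ f₍₂₎`. -/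
theorem IsHopfPairing.lid_rTensor_comul_mul {P : B →ₗ[k] H →ₗ[k] k} (hP : IsHopfPairing P)
    {x : B} (hx : Coalgebra.comul (R := k) x = x ⊗ₜ 1 + 1 ⊗ₜ x) (f g : H) :
    TensorProduct.lid k H ((P x).rTensor H (Coalgebra.comul (f * g))) =
      TensorProduct.lid k H ((P x).rTensor H (Coalgebra.comul f)) * g +
      f * TensorProduct.lid k H ((P x).rTensor H (Coalgebra.comul g)) := by
  have h : ∀ s t : H ⊗[k] H, TensorProduct.lid k H ((P x).rTensor H (s * t)) =
      TensorProduct.lid k H ((P x).rTensor H s) *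
        TensorProduct.lid k H ((Coalgebra.counit (R := k)).rTensor H t) +
      TensorProduct.lid k H ((Coalgebra.counit (R := k)).rTensor H s) *
        TensorProduct.lid k H ((P x).rTensor H t) := by
    intro s t
    induction s with
    | zero => simp
    | add x y hx hy => simp only [add_mul, map_add, hx, hy]; ring
    | tmul y y' =>
    induction t with
    | zero => simp
    | add x y hx hy => simp only [mul_add, map_add, hx, hy]; ring
    | tmul z z' => simp [hP.mul_primitive hx, Algebra.smul_def]; ring
  rw [Bialgebra.comul_mul, h, Coalgebra.rTensor_counit_comul, Coalgebra.rTensor_counit_comul]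
  simp

/-- A primitive element acts on `H` by the derivation `f ↦ ∑ f₍₁₎ ⟨x, f₍₂₎⟩`. -/
theorem IsHopfPairing.rid_lTensor_comul_mul {P : B →ₗ[k] H →ₗ[k] k} (hP : IsHopfPairing P)
    {x : B} (hx : Coalgebra.comul (R := k) x = x ⊗ₜ 1 + 1 ⊗ₜ x) (f g : H) :
    TensorProduct.rid k H ((P x).lTensor H (Coalgebra.comul (f * g))) =
      TensorProduct.rid k H ((P x).lTensor H (Coalgebra.comul f)) * g +
      f * TensorProduct.rid k H ((P x).lTensor H (Coalgebra.comul g)) := by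
  have h : ∀ s t : H ⊗[k] H, TensorProduct.rid k H ((P x).lTensor H (s * t)) =
      TensorProduct.rid k H ((P x).lTensor H s) *
        TensorProduct.rid k H ((Coalgebra.counit (R := k)).lTensor H t) +
      TensorProduct.rid k H ((Coalgebra.counit (R := k)).lTensor H s) *
        TensorProduct.rid k H ((P x).lTensor H t) := by
    intro s t
    induction s with
    | zero => simp
    | add x y hx hy => simp only [add_mul, map_add, hx, hy]; ring
    | tmul y y' =>
    induction t with
    | zero => simp
    | add x y hx hy => simp only [mul_add, map_add, hx, hy]; ring
    | tmul z z' => simp [hP.mul_primitive hx, Algebra.smul_def]; ring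
  rw [Bialgebra.comul_mul, h, Coalgebra.lTensor_counit_comul, Coalgebra.lTensor_counit_comul]
  simp

end PrimitiveDerivation

section AdPairing

variable {k h : Type*} [Field k] [AddCommGroup h] [Module k h] [LeftLeibnizAlgebra k h] {n : ℕ}
  {b : Module.Basis (Fin n) k h}

theorem tilde_eq_sum (b : Module.Basis (Fin n) k h) (x : h) :
    tilde k x = ∑ i, b.repr x i • tilde k (b i) := by
  conv_lhs => rw [← b.sum_repr x, ← tildeLin_apply]
  simp only [map_sum, map_smul, tildeLin_apply]

variable {P : ULie k h →ₗ[k] OAut b →ₗ[k] k}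

theorem IsAdPairing.tilde_G (hP : IsAdPairing b P) (x : h) (i j : Fin n) :
    P (tilde k x) (genG b i j) = b.repr (lbr k h x (b j)) i := by
  have := repr_map_eq_sum b ((lbr k h).flip (b j)) x i
  rw [LinearMap.flip_apply] at this
  rw [this, tilde_eq_sum b x, map_sum, LinearMap.sum_apply]
  refine Finset.sum_congr rfl fun l _ => ?_
  rw [map_smul, LinearMap.smul_apply, hP.2]
  rfl

/-- Since `x̃` is primitive, `G Ḡ = 1` forces `⟨x̃, Ḡ⟩ = -⟨x̃, G⟩`. -/
theorem IsAdPairing.tilde_Gbar (hP : IsAdPairing b P) (x : h) (i j : Fin n) :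
    P (tilde k x) (genGbar b i j) = - b.repr (lbr k h x (b j)) i := by
  have h1 := congrArg (P (tilde k x)) ((AutAlg.isAutPair (structConst b)).mul_inv i j)
  have h2 : P (tilde k x) (if i = j then 1 else 0) = 0 := by
    split_ifs
    · rw [hP.1.one_right, counit_tilde]
    · rw [map_zero]
  rw [h2, map_sum] at h1
  simp only [Matrix.of_apply, hP.1.mul_primitive (comul_tilde x), AutAlg.counit_Gbar,
    AutAlg.counit_G, hP.tilde_G] at h1
  rw [Finset.sum_add_distrib] at h1
  simp only [mul_ite, mul_one, mul_zero, Finset.sum_ite_eq', Finset.mem_univ, if_true, ite_mul,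
    one_mul, zero_mul, Finset.sum_ite_eq] at h1
  exact eq_neg_of_add_eq_zero_right h1

theorem IsAdPairing.unique {P P' : ULie k h →ₗ[k] OAut b →ₗ[k] k} (hP : IsAdPairing b P)
    (hP' : IsAdPairing b P') : P = P' := by
  ext u f
  induction u using uLie_induction generalizing f with
  | algebraMap c =>
    rw [Algebra.algebraMap_eq_smul_one, map_smul, map_smul, LinearMap.smul_apply,
      LinearMap.smul_apply, hP.1.one_left, hP'.1.one_left]
  | tilde x =>
    induction f using AutAlg.induction with
    | algebraMap c =>
      rw [hP.1.algebraMap_primitive (counit_tilde x), hP'.1.algebraMap_primitive (counit_tilde x)]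
    | G i j => rw [hP.tilde_G, hP'.tilde_G]
    | Gbar i j => rw [hP.tilde_Gbar, hP'.tilde_Gbar]
    | mul f g hf hg =>
      rw [hP.1.mul_primitive (comul_tilde x), hP'.1.mul_primitive (comul_tilde x), hf, hg]
    | add f g hf hg => rw [map_add, map_add, hf, hg]
  | mul u v hu hv =>
    rw [← hP.1.comul_right, ← hP'.1.comul_right]
    induction Coalgebra.comul (R := k) f with
    | zero => simp
    | add x y hx hy => rw [map_add, map_add, hx, hy]
    | tmul x y => rw [pairing₂_tmul, pairing₂_tmul, hu, hv]
  | add u v hu hv => rw [map_add, map_add, LinearMap.add_apply, LinearMap.add_apply, hu, hv]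

theorem IsAdPairing.pairingAction_tilde (hP : IsAdPairing b P) (x : h) (f : OAut b) :
    pairingAction P (tilde k x) f =
      P (tilde k x) f • 1 + Coalgebra.counit (R := k) f • tilde k x :=
  hP.1.pairingAction_primitive (comul_tilde x) f

/-- The right invariant derivation of `x_j` is `∑ Ḡ^i_j` times the left invariant derivation of
`x_i`: the two are related by the adjoint action. -/
theorem IsAdPairing.lid_rTensor_eq_sum (hP : IsAdPairing b P) (j : Fin n) (f : OAut b) :
    TensorProduct.lid k _ ((P (tilde k (b j))).rTensor (OAut b) (Coalgebra.comul f)) =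
      ∑ i, genGbar b i j * TensorProduct.rid k _
        ((P (tilde k (b i))).lTensor (OAut b) (Coalgebra.comul f)) := by
  induction f using AutAlg.induction with
  | algebraMap c =>
    have h (x : h) : P (tilde k x) 1 = 0 := by rw [hP.1.one_right, counit_tilde]
    simp [Algebra.algebraMap_eq_smul_one, Algebra.TensorProduct.one_def, h]
  | G p q =>
    have hom := fun i => (AutAlg.isAutPair (structConst b)).hom i q p
    have inv := fun l => (AutAlg.isAutPair (structConst b)).mul_inv l j
    simp only [Matrix.of_apply] at hom inv
    simp only [AutAlg.comul_G, map_sum, LinearMap.rTensor_tmul, LinearMap.lTensor_tmul,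
      TensorProduct.lid_tmul, TensorProduct.rid_tmul, hP.tilde_G]
    calc ∑ l, structConst b j l p • genG b l q
        = ∑ l, ∑ m, algebraMap k _ (structConst b l m p) *
            ((∑ i, genG b l i * genGbar b i j) * genG b m q) := by
          simp only [inv]
          rw [Finset.sum_comm]
          simp [Algebra.smul_def]
      _ = ∑ i, genGbar b i j * ∑ l, ∑ m, algebraMap k _ (structConst b l m p) *
            (genG b l i * genG b m q) := by
          simp only [Finset.mul_sum, Finset.sum_mul]
          rw [Finset.sum_comm_cycle]
          refine Finset.sum_congr rfl fun i _ => Finset.sum_congr rfl fun l _ =>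
            Finset.sum_congr rfl fun m _ => ?_
          ring
      _ = _ := by
          refine Finset.sum_congr rfl fun i _ => congrArg _ ((hom i).trans ?_)
          refine Finset.sum_congr rfl fun r _ => ?_
          rw [mul_comm, ← Algebra.smul_def]
          rfl
  | Gbar p q =>
    have hom := (AutAlg.isAutPair (structConst b)).inv.hom j q p
    simp only [Matrix.of_apply] at hom
    simp only [AutAlg.comul_Gbar, map_sum, LinearMap.rTensor_tmul, LinearMap.lTensor_tmul,
      TensorProduct.lid_tmul, TensorProduct.rid_tmul, hP.tilde_Gbar, neg_smul,
      Finset.sum_neg_distrib, mul_neg, Finset.mul_sum]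
    congr 1
    calc ∑ l, structConst b j q l • genGbar b p l
        = ∑ r, genGbar b p r * algebraMap k _ (structConst b j q r) := by
          simp only [Algebra.smul_def, mul_comm]
      _ = _ := by
          rw [← hom]
          refine Finset.sum_congr rfl fun i _ => Finset.sum_congr rfl fun l _ => ?_
          rw [mul_smul_comm, Algebra.smul_def]
          rfl
  | mul f g hf hg =>
    rw [hP.1.lid_rTensor_comul_mul (comul_tilde _), hf, hg, Finset.sum_mul, Finset.mul_sum,
      ← Finset.sum_add_distrib]
    refine Finset.sum_congr rfl fun i _ => ?_
    rw [hP.1.rid_lTensor_comul_mul (comul_tilde _)]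
    ring
  | add f g hf hg => simp only [map_add, hf, hg, mul_add, Finset.sum_add_distrib]

end AdPairing

end LeibnizYD

/-! ### The antimultiplicative map and the coaction -/

namespace LeibnizYD

section Lambda

variable {k h : Type*} [Field k] [AddCommGroup h] [Module k h] [LeftLeibnizAlgebra k h] {n : ℕ}

/-- The linear map `x_j ↦ ∑ Ḡ^i_j ⊗ x̃_i`. -/
noncomputable def lambdaGen (b : Module.Basis (Fin n) k h) : h →ₗ[k] OAut b ⊗[k] ULie k h :=
  b.constr k fun j => ∑ i, genGbar b i j ⊗ₜ tilde k (b i)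

@[simp] theorem lambdaGen_basis (b : Module.Basis (Fin n) k h) (j : Fin n) :
    lambdaGen b (b j) = ∑ i, genGbar b i j ⊗ₜ tilde k (b i) := by
  simp [lambdaGen]

/-- The inverse automorphism is multiplicative as well, so `x ↦ ∑ Ḡ ⊗ x̃` turns the bracket into
the commutator of the ordinary tensor product algebra. -/
theorem lambdaGen_lbr (b : Module.Basis (Fin n) k h) (x y : h) : lambdaGen b (lbr k h x y) =
    lambdaGen b x * lambdaGen b y - lambdaGen b y * lambdaGen b x := by
  let m : h →ₗ[k] h →ₗ[k] OAut b ⊗[k] ULie k h :=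
    (LinearMap.mul k (OAut b ⊗[k] ULie k h)).compl₁₂ (lambdaGen b) (lambdaGen b)
  have : (lbr k h).compr₂ (lambdaGen b) = m - m.flip := by
    refine LinearMap.ext_basis b b fun i j => ?_
    have hom := fun p => (AutAlg.isAutPair (structConst b)).inv.hom i j p
    simp only [Matrix.of_apply] at hom
    have h1 : lambdaGen b (lbr k h (b i) (b j)) = ∑ r, structConst b i j r •
        lambdaGen b (b r) := by
      conv_lhs => rw [← b.sum_repr (lbr k h (b i) (b j)), map_sum]
      simp only [map_smul]
      rfl
    have h2 : ∀ p q, tilde k (b p) * tilde k (b q) - tilde k (b q) * tilde k (b p) =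
        ∑ s, structConst b p q s • tilde k (b s) := fun p q => by
      rw [← tilde_lbr, tilde_eq_sum b]
      rfl
    change lambdaGen b (lbr k h (b i) (b j)) =
      lambdaGen b (b i) * lambdaGen b (b j) - lambdaGen b (b j) * lambdaGen b (b i)
    calc lambdaGen b (lbr k h (b i) (b j))
        = ∑ s, (∑ r, genGbar b s r * algebraMap k _ (structConst b i j r)) ⊗ₜ tilde k (b s) := by
          simp only [h1, lambdaGen_basis, Finset.smul_sum, TensorProduct.sum_tmul,
            TensorProduct.smul_tmul']
          rw [Finset.sum_comm]
          simp only [Algebra.smul_def, mul_comm]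
      _ = ∑ s, (∑ p, ∑ q, algebraMap k _ (structConst b p q s) *
            (genGbar b p i * genGbar b q j)) ⊗ₜ tilde k (b s) := by
          refine Finset.sum_congr rfl fun s _ => ?_
          exact congrArg (· ⊗ₜ[k] tilde k (b s)) (hom s).symm
      _ = ∑ p, ∑ q, (genGbar b p i * genGbar b q j) ⊗ₜ
            (tilde k (b p) * tilde k (b q) - tilde k (b q) * tilde k (b p)) := by
          simp only [h2, TensorProduct.sum_tmul, TensorProduct.tmul_sum, TensorProduct.tmul_smul,
            ← Algebra.smul_def, TensorProduct.smul_tmul']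
          exact Finset.sum_comm_cycle.symm
      _ = _ := by
          simp only [lambdaGen_basis, Finset.sum_mul_sum, Algebra.TensorProduct.tmul_mul_tmul,
            TensorProduct.tmul_sub, Finset.sum_sub_distrib]
          congr 1
          rw [Finset.sum_comm]
          simp only [mul_comm]
  exact LinearMap.congr_fun₂ this x y

/-- The algebra map `x̃_j ↦ ∑ Ḡ^i_j ⊗ x̃_i` to the ordinary tensor product algebra. -/
noncomputable def lambdaHom (b : Module.Basis (Fin n) k h) :
    ULie k h →ₐ[k] OAut b ⊗[k] ULie k h :=
  uLieLift (lambdaGen b) (lambdaGen_lbr b)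

variable {b : Module.Basis (Fin n) k h}

theorem lambdaHom_basis (j : Fin n) :
    lambdaHom b (tilde k (b j)) = ∑ i, genGbar b i j ⊗ₜ tilde k (b i) := by
  rw [lambdaHom, uLieLift_tilde, lambdaGen_basis]

/-- For commutative `H` the first factor of `H ⊗ A` is central. -/
theorem mul_tmul_eq {R H A : Type*} [CommRing R] [CommRing H] [Algebra R H] [Ring A] [Algebra R A]
    (t : H ⊗[R] A) (g : H) (c : A) : t * (g ⊗ₜ c) = (g ⊗ₜ 1) * (t * (1 ⊗ₜ c)) := by
  induction t with
  | zero => simp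
  | add x y hx hy => simp only [add_mul, mul_add, hx, hy]
  | tmul x y => simp [mul_comm]

/-- An induction principle for `U(h_Lie)` with generators the basis of `h`. -/
@[elab_as_elim]
theorem uLie_basis_induction (b : Module.Basis (Fin n) k h) {p : ULie k h → Prop}
    (algebraMap : ∀ c, p (algebraMap k _ c)) (tilde : ∀ j, p (tilde k (b j)))
    (mul : ∀ u v, p u → p v → p (u * v)) (add : ∀ u v, p u → p v → p (u + v))
    (u : ULie k h) : p u := by
  refine uLie_induction algebraMap (fun x => ?_) mul add u
  rw [tilde_eq_sum b]
  refine Finset.sum_induction _ p add (by simpa using algebraMap 0) fun i _ => ?_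
  rw [Algebra.smul_def]
  exact mul _ _ (algebraMap _) (tilde i)

variable {P : ULie k h →ₗ[k] OAut b →ₗ[k] k}

/-- On generators, `1 ♯ U` commutes with `Im λ` because `∑ (x ◁ Ḡ^i_l) x̃_i = x̃_l x̃`, where the
left side is `x̃ x̃_l - [x, x_l]~`. -/
theorem IsAdPairing.tilde_smashMul_lambdaHom (hP : IsAdPairing b P) (x : h) (j : Fin n) :
    smashMul (pairingAction P) (1 ⊗ₜ tilde k x) (lambdaHom b (tilde k (b j))) =
      lambdaHom b (tilde k (b j)) * (1 ⊗ₜ tilde k x) := by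
  have h1 : ∀ l, ∑ i, pairingAction P (tilde k x) (genGbar b i l) * tilde k (b i) =
      tilde k (b l) * tilde k x := by
    intro l
    simp only [hP.pairingAction_tilde, hP.tilde_Gbar, AutAlg.counit_Gbar, add_mul, neg_smul,
      Finset.sum_add_distrib, neg_mul, Finset.sum_neg_distrib, smul_mul_assoc, one_mul]
    rw [← tilde_eq_sum b, tilde_lbr]
    simp
  simp only [lambdaHom_basis, map_sum, smashMul_tmul, AutAlg.comul_Gbar, TensorProduct.map_tmul,
    LinearMap.mulLeft_apply, one_mul, LinearMap.comp_apply, LinearMap.mulRight_apply,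
    Finset.sum_mul, Algebra.TensorProduct.tmul_mul_tmul, mul_one]
  rw [Finset.sum_comm]
  simp only [← TensorProduct.tmul_sum, h1]

/-- Right multiplication by `λ(u)` in the smash product is left multiplication by `λ(u)` in the
ordinary tensor product algebra. -/
theorem IsAdPairing.smashMul_lambdaHom (hP : IsAdPairing b P) (u : ULie k h)
    (s : OAut b ⊗[k] ULie k h) :
    smashMul (pairingAction P) s (lambdaHom b u) = lambdaHom b u * s := by
  have hact := hP.1.isRightModuleAlgebra
  have hA := hact.isAssocUnital_smashMul
  induction u using uLie_basis_induction b generalizing s with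
  | algebraMap c =>
    rw [AlgHom.commutes, Algebra.algebraMap_eq_smul_one, map_smul, Algebra.TensorProduct.one_def,
      hA.mul_one, ← Algebra.TensorProduct.one_def, smul_one_mul]
  | tilde j =>
    have h1 : ∀ v, smashMul (pairingAction P) (1 ⊗ₜ v) (lambdaHom b (tilde k (b j))) =
        lambdaHom b (tilde k (b j)) * (1 ⊗ₜ v) := by
      intro v
      induction v using uLie_induction with
      | algebraMap c =>
        rw [Algebra.algebraMap_eq_smul_one, TensorProduct.tmul_smul, map_smul,
          LinearMap.smul_apply, hA.one_mul, ← Algebra.TensorProduct.one_def, mul_smul_one]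
      | tilde x => exact hP.tilde_smashMul_lambdaHom x j
      | mul v w hv hw =>
        have h2 : (1 : OAut b) ⊗ₜ[k] (v * w) = (1 ⊗ₜ v) * (1 ⊗ₜ w) := by simp
        rw [h2, ← hact.smashMul_one_tmul, hA.assoc, hw, ← hact.smashMul_one_tmul, ← hA.assoc, hv,
          hact.smashMul_one_tmul, hact.smashMul_one_tmul, mul_assoc]
      | add v w hv hw =>
        simp only [TensorProduct.tmul_add, map_add, LinearMap.add_apply, mul_add, hv, hw]
    induction s with
    | zero => simp
    | add x y hx hy => simp only [map_add, LinearMap.add_apply, mul_add, hx, hy]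
    | tmul g c =>
      rw [mul_tmul_eq, ← h1, ← hact.smashMul_tmul_one, ← hA.assoc, hact.smashMul_tmul_one]
      simp
  | mul u v hu hv => 
    rw [map_mul, mul_assoc, ← hv s, ← hu (smashMul _ s _), ← hu (lambdaHom b v), hA.assoc]
  | add u v hu hv => simp only [map_add, add_mul, hu, hv]

theorem IsAdPairing.isLambda_lambdaHom (hP : IsAdPairing b P) :
    IsLambda b (pairingAction P) (lambdaHom b).toLinearMap where
  map_one := map_one (lambdaHom b)
  map_mul u v := (map_mul (lambdaHom b) u v).trans (hP.smashMul_lambdaHom u _).symm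
  map_gen j := lambdaHom_basis j

theorem IsLambda.unique {act : ULie k h →ₗ[k] OAut b →ₗ[k] ULie k h}
    {lam lam' : ULie k h →ₗ[k] OAut b ⊗[k] ULie k h} (hlam : IsLambda b act lam)
    (hlam' : IsLambda b act lam') : lam = lam' := by
  ext u
  induction u using uLie_basis_induction b with
  | algebraMap c =>
    rw [Algebra.algebraMap_eq_smul_one, map_smul, map_smul, hlam.map_one, hlam'.map_one]
  | tilde j => rw [hlam.map_gen, hlam'.map_gen]
  | mul u v hu hv => rw [hlam.map_mul, hlam'.map_mul, hu, hv]
  | add u v hu hv => rw [map_add, map_add, hu, hv]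

/-- Both sides of the two coaction identities are algebra maps, so it suffices to compare them on
generators. -/
theorem isLeftCoaction_lambdaHom : IsLeftCoaction (lambdaHom b).toLinearMap where
  coassoc u := by
    let f₁ : ULie k h →ₐ[k] OAut b ⊗[k] (OAut b ⊗[k] ULie k h) :=
      (Algebra.TensorProduct.assoc k k k (OAut b) (OAut b) (ULie k h)).toAlgHom.comp
        ((Algebra.TensorProduct.map (Bialgebra.comulAlgHom k (OAut b)) (AlgHom.id k _)).comp
          (lambdaHom b))
    let f₂ : ULie k h →ₐ[k] OAut b ⊗[k] (OAut b ⊗[k] ULie k h) :=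
      (Algebra.TensorProduct.map (AlgHom.id k _) (lambdaHom b)).comp (lambdaHom b)
    change f₁ u = f₂ u
    induction u using uLie_basis_induction b with
    | algebraMap c => rw [AlgHom.commutes, AlgHom.commutes]
    | tilde j =>
      simp [f₁, f₂, lambdaHom_basis, TensorProduct.sum_tmul, TensorProduct.tmul_sum]
      exact Finset.sum_comm
    | mul u v hu hv => rw [map_mul, map_mul, hu, hv]
    | add u v hu hv => rw [map_add, map_add, hu, hv]
  counit u := by
    let f : ULie k h →ₐ[k] ULie k h :=
      (Algebra.TensorProduct.lid k (ULie k h)).toAlgHom.comp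
        ((Algebra.TensorProduct.map (Bialgebra.counitAlgHom k (OAut b)) (AlgHom.id k _)).comp
          (lambdaHom b))
    change f u = u
    induction u using uLie_basis_induction b with
    | algebraMap c => rw [AlgHom.commutes]
    | tilde j => simp [f, lambdaHom_basis]
    | mul u v hu hv => rw [map_mul, hu, hv]
    | add u v hu hv => rw [map_add, hu, hv]

theorem IsAdPairing.yetterDrinfeld_basis (hP : IsAdPairing b P) (j : Fin n) (f : OAut b) :
    ydLeft (pairingAction P) (lambdaHom b).toLinearMap (tilde k (b j)) f =
      ydRight (pairingAction P) (lambdaHom b).toLinearMap (tilde k (b j)) f := by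
  -- Since `x ◁ f = ⟨x, f⟩ 1 + ε(f) x`, the two sides are the right and left invariant derivation of
  -- `f`, respectively, plus the common term `f λ(x_j)`.
  have h1 : ∀ z : OAut b ⊗[k] OAut b,
      ydLeftMap (pairingAction P) (lambdaHom b).toLinearMap (tilde k (b j)) z =
      TensorProduct.lid k _ ((P (tilde k (b j))).rTensor (OAut b) z) ⊗ₜ 1 +
      (TensorProduct.lid k _ ((Coalgebra.counit (R := k)).rTensor (OAut b) z) ⊗ₜ 1) *
        lambdaHom b (tilde k (b j)) := by
    intro z
    induction z with
    | zero => simp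
    | add x y hx hy => simp only [map_add, TensorProduct.add_tmul, add_mul, hx, hy]; abel
    | tmul x y =>
      rw [ydLeftMap_tmul, hP.pairingAction_tilde]
      simp [mul_add, TensorProduct.smul_tmul']
      rw [← TensorProduct.smul_tmul', smul_mul_assoc]
  have h2 : ∀ (i : Fin n) (z : OAut b ⊗[k] OAut b),
      TensorProduct.map₂ (LinearMap.mul k (OAut b)) (pairingAction P)
        (genGbar b i j ⊗ₜ tilde k (b i)) z =
      (genGbar b i j * TensorProduct.rid k _ ((P (tilde k (b i))).lTensor (OAut b) z)) ⊗ₜ 1 +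
      (TensorProduct.rid k _ ((Coalgebra.counit (R := k)).lTensor (OAut b) z) ⊗ₜ 1) *
        (genGbar b i j ⊗ₜ tilde k (b i)) := by
    intro i z
    induction z with
    | zero => simp
    | add x y hx hy => simp only [map_add, TensorProduct.add_tmul, add_mul, mul_add, hx, hy]; abel
    | tmul x y =>
      simp [hP.pairingAction_tilde, TensorProduct.tmul_add, TensorProduct.smul_tmul',
        mul_comm]
  rw [ydLeft_eq_ydLeftMap, h1, ydRight, AlgHom.toLinearMap_apply, lambdaHom_basis, map_sum,
    LinearMap.sum_apply]
  simp only [h2, Coalgebra.rTensor_counit_comul, Coalgebra.lTensor_counit_comul,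
    Finset.sum_add_distrib, ← TensorProduct.sum_tmul, ← Finset.mul_sum, hP.lid_rTensor_eq_sum]
  simp

theorem IsAdPairing.yetterDrinfeld (hP : IsAdPairing b P) (u : ULie k h) (f : OAut b) :
    ydLeft (pairingAction P) (lambdaHom b).toLinearMap u f =
      ydRight (pairingAction P) (lambdaHom b).toLinearMap u f := by
  have hact := hP.1.isRightModuleAlgebra
  induction u using uLie_basis_induction b generalizing f with
  | algebraMap c =>
    have h1 : ∀ z : OAut b ⊗[k] OAut b,
        ydLeftMap (pairingAction P) (lambdaHom b).toLinearMap (algebraMap k _ c) z =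
        c • (TensorProduct.lid k _ ((Coalgebra.counit (R := k)).rTensor (OAut b) z) ⊗ₜ 1) := by
      intro z
      induction z with
      | zero => simp
      | add x y hx hy => simp only [map_add, TensorProduct.add_tmul, smul_add, hx, hy]
      | tmul x y =>
        rw [ydLeftMap_tmul, Algebra.algebraMap_eq_smul_one, map_smul, LinearMap.smul_apply,
          hact.one_act, map_smul, map_smul, AlgHom.toLinearMap_apply, map_one, mul_smul_comm,
          mul_smul_comm, mul_one]
        simp [TensorProduct.smul_tmul']
    rw [ydLeft_eq_ydLeftMap, h1, ydRight_eq_smashMul, Coalgebra.rTensor_counit_comul,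
      AlgHom.toLinearMap_apply, AlgHom.commutes, Algebra.algebraMap_eq_smul_one, map_smul,
      LinearMap.smul_apply, Algebra.TensorProduct.one_def, hact.isAssocUnital_smashMul.one_mul]
    simp
  | tilde j => exact hP.yetterDrinfeld_basis j f
  | mul u v hu hv => exact hact.yetterDrinfeld_mul hP.isLambda_lambdaHom.map_mul hu hv f
  | add u v hu hv =>
    have h1 : ydLeftMap (pairingAction P) (lambdaHom b).toLinearMap (u + v) =
        ydLeftMap (pairingAction P) (lambdaHom b).toLinearMap u +
        ydLeftMap (pairingAction P) (lambdaHom b).toLinearMap v := by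
      ext x y
      simp [ydLeftMap_tmul, mul_add]
    have hu := hu f
    have hv := hv f
    rw [ydRight_eq_smashMul, ydLeft_eq_ydLeftMap] at hu hv ⊢
    rw [h1, LinearMap.add_apply, hu, hv, map_add, map_add, LinearMap.add_apply]

theorem IsAdPairing.isBraidedComm (hP : IsAdPairing b P) :
    IsBraidedCommYDModuleAlgebra (pairingAction P) (lambdaHom b).toLinearMap where
  moduleAlgebra := hP.1.isRightModuleAlgebra
  coaction := isLeftCoaction_lambdaHom
  yetterDrinfeld := hP.yetterDrinfeld
  comodule_mul u v := by
    simp only [AlgHom.toLinearMap_apply, map_mul]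
    induction lambdaHom b u with
    | zero => simp
    | add x y hx hy => simp only [map_add, LinearMap.add_apply, add_mul, hx, hy]
    | tmul x y =>
    induction lambdaHom b v with
    | zero => simp
    | add x y hx hy => simp only [map_add, mul_add, hx, hy]
    | tmul z w => simp
  comodule_one := map_one (lambdaHom b)
  braidedComm := by
    ext u v
    have hact := hP.1.isRightModuleAlgebra
    refine hact.mul'_ydBraiding_tmul isLeftCoaction_lambdaHom ?_
    rw [hact.smashMul_one_tmul]
    exact (hP.smashMul_lambdaHom u _).symm

end Lambda

end LeibnizYD

/-! ### Change of basis -/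

namespace LeibnizYD

section BaseChange

open scoped Kronecker

/-- An automorphism of a structure is conjugated by a change of basis `T`, with inverse `S`, to an
automorphism of the structure transported along `T`. -/
theorem IsAutPair.conj {k A : Type*} [CommRing k] [CommRing A] [Algebra k A] {n : ℕ}
    {C C' : Fin n → Fin n → Fin n → k} {M N S T : Matrix (Fin n) (Fin n) A}
    (h : IsAutPair C M N) (hST : S * T = 1) (hTS : T * S = 1)
    (hC : IsAutPair.cMat C' A = S * IsAutPair.cMat C A * (T ⊗ₖ T)) :
    IsAutPair C' (S * M * T) (S * N * T) := by
  rw [IsAutPair.iff_matrix] at *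
  obtain ⟨h1, h2, h3⟩ := h
  have key : ∀ X Y : Matrix (Fin n) (Fin n) A, X * Y = 1 → S * X * T * (S * Y * T) = 1 := by
    intro X Y hXY
    calc S * X * T * (S * Y * T) = S * X * (T * S) * Y * T := by simp only [Matrix.mul_assoc]
      _ = S * (X * Y) * T := by rw [hTS, Matrix.mul_one]; simp only [Matrix.mul_assoc]
      _ = 1 := by rw [hXY, Matrix.mul_one, hST]
  refine ⟨key _ _ h1, key _ _ h2, ?_⟩
  calc IsAutPair.cMat C' A * ((S * M * T) ⊗ₖ (S * M * T))
      = S * IsAutPair.cMat C A * (((T * S) ⊗ₖ (T * S)) * ((M ⊗ₖ M) * (T ⊗ₖ T))) := by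
        rw [hC, Matrix.mul_kronecker_mul T S T S]
        simp only [Matrix.mul_kronecker_mul, Matrix.mul_assoc]
    _ = S * (IsAutPair.cMat C A * (M ⊗ₖ M)) * (T ⊗ₖ T) := by
        rw [hTS]; simp [Matrix.mul_assoc]
    _ = S * M * (T * S) * IsAutPair.cMat C A * (T ⊗ₖ T) := by
        rw [h3, hTS, Matrix.mul_one]; simp only [Matrix.mul_assoc]
    _ = S * M * T * IsAutPair.cMat C' A := by rw [hC]; simp only [Matrix.mul_assoc]

variable {k h : Type*} [Field k] [AddCommGroup h] [Module k h] {n : ℕ}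
  (b b' : Module.Basis (Fin n) k h)

/-- The transition matrix from `b'` to `b` with entries in the algebra `A`. -/
noncomputable def transition (A : Type*) [CommRing A] [Algebra k A] : Matrix (Fin n) (Fin n) A :=
  (b.toMatrix b').map (algebraMap k A)

theorem transition_apply (A : Type*) [CommRing A] [Algebra k A] (i j : Fin n) :
    transition b b' A i j = algebraMap k A (b.repr (b' j) i) := rfl

theorem transition_mul_transition (A : Type*) [CommRing A] [Algebra k A] :
    transition b b' A * transition b' b A = 1 := by
  rw [transition, transition, ← Matrix.map_mul, Module.Basis.toMatrix_mul_toMatrix_flip]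
  simp

theorem mapMatrix_transition {A B : Type*} [CommRing A] [Algebra k A] [CommRing B] [Algebra k B]
    (f : A →ₐ[k] B) : f.mapMatrix (transition b b' A) = transition b b' B := by
  ext i j
  simp [transition_apply]

theorem apply_eq_sum_repr (f : h →ₗ[k] k) (v : h) : f v = ∑ r, b.repr v r * f (b r) := by
  conv_lhs => rw [← b.sum_repr v]
  simp only [map_sum, map_smul, smul_eq_mul]

variable [LeftLeibnizAlgebra k h]

theorem structConst_baseChange (i j p : Fin n) : structConst b' i j p =
    ∑ a, ∑ c, (∑ l, b'.repr (b l) p * structConst b a c l) *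
      (b.repr (b' i) a * b.repr (b' j) c) := by
  have h1 := apply_eq_sum_repr b (b'.coord p) (lbr k h (b' i) (b' j))
  have h2 : ∀ l, b.repr (lbr k h (b' i) (b' j)) l =
      ∑ a, ∑ c, b.repr (b' i) a * (b.repr (b' j) c * structConst b a c l) := by
    intro l
    have h3 := repr_map_eq_sum b ((lbr k h).flip (b' j)) (b' i) l
    simp only [LinearMap.flip_apply] at h3
    rw [h3]
    refine Finset.sum_congr rfl fun a _ => ?_
    rw [repr_map_eq_sum b (lbr k h (b a)) (b' j) l, Finset.mul_sum]
    rfl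
  simp only [Module.Basis.coord_apply, h2] at h1
  rw [structConst, h1]
  simp only [Finset.sum_mul]
  rw [Finset.sum_comm_cycle]
  rw [Finset.sum_comm_cycle]
  refine Finset.sum_congr rfl fun a _ => Finset.sum_congr rfl fun c _ =>
    Finset.sum_congr rfl fun l _ => ?_
  ring

theorem cMat_baseChange (A : Type*) [CommRing A] [Algebra k A] :
    IsAutPair.cMat (structConst b') A = transition b' b A * IsAutPair.cMat (structConst b) A *
      (transition b b' A ⊗ₖ transition b b' A) := by
  ext p ⟨i, j⟩
  simp [IsAutPair.cMat, Matrix.mul_apply, Fintype.sum_prod_type, structConst_baseChange b b' i j p,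
    transition_apply]

theorem isAutPair_baseChange : IsAutPair (structConst b')
    (transition b' b (OAut b) * Matrix.of (AutAlg.G (structConst b)) * transition b b' (OAut b))
    (transition b' b (OAut b) * Matrix.of (AutAlg.Gbar (structConst b)) *
      transition b b' (OAut b)) :=
  (AutAlg.isAutPair (structConst b)).conj
    (transition_mul_transition b' b (OAut b)) (transition_mul_transition b b' (OAut b))
    (cMat_baseChange b b' (OAut b))

/-- The algebra map `G' ↦ T⁻¹ G T`, `Ḡ' ↦ T⁻¹ Ḡ T` between the presentations of `O(Aut(h))` in two
bases. -/
noncomputable def baseChangeHom : OAut b' →ₐ[k] OAut b :=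
  AutAlg.lift (isAutPair_baseChange b b')

/-- The matrix of the generators `G`. -/
noncomputable def matG : Matrix (Fin n) (Fin n) (OAut b) := Matrix.of (AutAlg.G (structConst b))

/-- The matrix of the generators `Ḡ`. -/
noncomputable def matGbar : Matrix (Fin n) (Fin n) (OAut b) :=
  Matrix.of (AutAlg.Gbar (structConst b))

theorem mapMatrix_baseChangeHom_matG : (baseChangeHom b b').mapMatrix (matG b') =
    transition b' b _ * matG b * transition b b' _ := by
  ext i j
  exact AutAlg.lift_G (isAutPair_baseChange b b') i j

theorem mapMatrix_baseChangeHom_matGbar : (baseChangeHom b b').mapMatrix (matGbar b') =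
    transition b' b _ * matGbar b * transition b b' _ := by
  ext i j
  exact AutAlg.lift_Gbar (isAutPair_baseChange b b') i j

variable {b} in
theorem oAut_algHom_ext {A : Type*} [Semiring A] [Algebra k A] {f g : OAut b →ₐ[k] A}
    (h1 : f.mapMatrix (matG b) = g.mapMatrix (matG b))
    (h2 : f.mapMatrix (matGbar b) = g.mapMatrix (matGbar b)) : f = g :=
  AutAlg.algHom_ext (fun i j => congrFun (congrFun h1 i) j) fun i j => congrFun (congrFun h2 i) j

theorem mapMatrix_comul_matG : (Bialgebra.comulAlgHom k (OAut b)).mapMatrix (matG b) =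
    (Algebra.TensorProduct.includeLeft : OAut b →ₐ[k] OAut b ⊗[k] OAut b).mapMatrix (matG b) *
      (Algebra.TensorProduct.includeRight : OAut b →ₐ[k] OAut b ⊗[k] OAut b).mapMatrix
        (matG b) := by
  ext i j
  exact (AutAlg.comul_G i j).trans (by simp [Matrix.mul_apply, matG])

theorem mapMatrix_comul_matGbar : (Bialgebra.comulAlgHom k (OAut b)).mapMatrix (matGbar b) =
    (Algebra.TensorProduct.includeRight : OAut b →ₐ[k] OAut b ⊗[k] OAut b).mapMatrix (matGbar b) *
      (Algebra.TensorProduct.includeLeft : OAut b →ₐ[k] OAut b ⊗[k] OAut b).mapMatrix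
        (matGbar b) := by
  ext i j
  exact (AutAlg.comul_Gbar i j).trans (by simp [Matrix.mul_apply, matGbar])

theorem mapMatrix_counit_matG : (Bialgebra.counitAlgHom k (OAut b)).mapMatrix (matG b) = 1 := by
  ext i j
  exact AutAlg.lift_G (IsAutPair.one (C := structConst b) (A := k)) i j

theorem mapMatrix_counit_matGbar :
    (Bialgebra.counitAlgHom k (OAut b)).mapMatrix (matGbar b) = 1 := by
  ext i j
  exact AutAlg.lift_Gbar (IsAutPair.one (C := structConst b) (A := k)) i j

theorem mapMatrix_comp {A B D : Type*} [CommRing A] [Algebra k A] [CommRing B] [Algebra k B]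
    [CommRing D] [Algebra k D] (f : B →ₐ[k] D) (g : A →ₐ[k] B) (M : Matrix (Fin n) (Fin n) A) :
    (f.comp g).mapMatrix M = f.mapMatrix (g.mapMatrix M) := rfl

theorem counit_comp_baseChangeHom : (Bialgebra.counitAlgHom k (OAut b)).comp (baseChangeHom b b') =
    Bialgebra.counitAlgHom k (OAut b') := by
  apply oAut_algHom_ext
  · rw [mapMatrix_comp, mapMatrix_baseChangeHom_matG, map_mul, map_mul, mapMatrix_counit_matG,
      mapMatrix_counit_matG, mapMatrix_transition, mapMatrix_transition, mul_one,
      transition_mul_transition]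
  · rw [mapMatrix_comp, mapMatrix_baseChangeHom_matGbar, map_mul, map_mul,
      mapMatrix_counit_matGbar, mapMatrix_counit_matGbar, mapMatrix_transition,
      mapMatrix_transition, mul_one, transition_mul_transition]

theorem comul_comp_baseChangeHom :
    (Algebra.TensorProduct.map (baseChangeHom b b') (baseChangeHom b b')).comp
      (Bialgebra.comulAlgHom k (OAut b')) =
    (Bialgebra.comulAlgHom k (OAut b)).comp (baseChangeHom b b') := by
  have hl : (Algebra.TensorProduct.map (baseChangeHom b b') (baseChangeHom b b')).comp
      (Algebra.TensorProduct.includeLeft : OAut b' →ₐ[k] OAut b' ⊗[k] OAut b') =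
      (Algebra.TensorProduct.includeLeft : OAut b →ₐ[k] OAut b ⊗[k] OAut b).comp
        (baseChangeHom b b') := by
    ext f; simp
  have hr : (Algebra.TensorProduct.map (baseChangeHom b b') (baseChangeHom b b')).comp
      (Algebra.TensorProduct.includeRight : OAut b' →ₐ[k] OAut b' ⊗[k] OAut b') =
      (Algebra.TensorProduct.includeRight : OAut b →ₐ[k] OAut b ⊗[k] OAut b).comp
        (baseChangeHom b b') := by
    ext f; simp
  have key : ∀ (A : Type _) [CommRing A] [Algebra k A] (X Y : Matrix (Fin n) (Fin n) A),
      transition b' b A * X * transition b b' A * (transition b' b A * Y * transition b b' A) =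
        transition b' b A * (X * Y) * transition b b' A := by
    intro A _ _ X Y
    calc _ = transition b' b A * X * (transition b b' A * transition b' b A) * Y *
          transition b b' A := by simp only [mul_assoc]
      _ = _ := by rw [transition_mul_transition, mul_one]; simp only [mul_assoc]
  apply oAut_algHom_ext
  · rw [mapMatrix_comp, mapMatrix_comp, mapMatrix_comul_matG, map_mul, ← mapMatrix_comp,
      ← mapMatrix_comp, hl, hr, mapMatrix_comp, mapMatrix_comp, mapMatrix_baseChangeHom_matG]
    simp only [map_mul, mapMatrix_transition]
    rw [key, mapMatrix_comul_matG]
  · rw [mapMatrix_comp, mapMatrix_comp, mapMatrix_comul_matGbar, map_mul, ← mapMatrix_comp,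
      ← mapMatrix_comp, hl, hr, mapMatrix_comp, mapMatrix_comp, mapMatrix_baseChangeHom_matGbar]
    simp only [map_mul, mapMatrix_transition]
    rw [key, mapMatrix_comul_matGbar]

theorem baseChangeHom_comp :
    (baseChangeHom b b').comp (baseChangeHom b' b) = AlgHom.id k (OAut b) := by
  have key : ∀ X : Matrix (Fin n) (Fin n) (OAut b), transition b b' _ *
      (transition b' b _ * X * transition b b' _) * transition b' b _ = X := by
    intro X
    calc _ = (transition b b' _ * transition b' b _) * X *
          (transition b b' _ * transition b' b _) := by simp only [mul_assoc]
      _ = _ := by rw [transition_mul_transition, one_mul, mul_one]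
  apply oAut_algHom_ext
  · rw [mapMatrix_comp, mapMatrix_baseChangeHom_matG]
    simp only [map_mul, mapMatrix_transition]
    rw [mapMatrix_baseChangeHom_matG, key]
    rfl
  · rw [mapMatrix_comp, mapMatrix_baseChangeHom_matGbar]
    simp only [map_mul, mapMatrix_transition]
    rw [mapMatrix_baseChangeHom_matGbar, key]
    rfl

/-- The Hopf algebra isomorphism between the presentations of `O(Aut(h))` in two bases. -/
noncomputable def baseChange : OAut b' ≃ₐc[k] OAut b :=
  BialgEquiv.ofAlgEquiv
    (AlgEquiv.ofAlgHom (baseChangeHom b b') (baseChangeHom b' b) (baseChangeHom_comp b b')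
      (baseChangeHom_comp b' b))
    (counit_comp_baseChangeHom b b') (comul_comp_baseChangeHom b b')

theorem baseChange_G (i j : Fin n) : baseChange b b' (genG b' i j) =
    ∑ l, ∑ m, (b'.repr (b l) i * b.repr (b' j) m) • genG b l m := by
  refine (AutAlg.lift_G (isAutPair_baseChange b b') i j).trans ?_
  simp only [Matrix.mul_apply, transition_apply, Finset.sum_mul, Matrix.of_apply]
  rw [Finset.sum_comm]
  refine Finset.sum_congr rfl fun l _ => Finset.sum_congr rfl fun m _ => ?_
  rw [Algebra.smul_def, map_mul]
  ring

theorem baseChange_Gbar (i j : Fin n) : baseChange b b' (genGbar b' i j) =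
    ∑ l, ∑ m, (b'.repr (b l) i * b.repr (b' j) m) • genGbar b l m := by
  refine (AutAlg.lift_Gbar (isAutPair_baseChange b b') i j).trans ?_
  simp only [Matrix.mul_apply, transition_apply, Finset.sum_mul, Matrix.of_apply]
  rw [Finset.sum_comm]
  refine Finset.sum_congr rfl fun l _ => Finset.sum_congr rfl fun m _ => ?_
  rw [Algebra.smul_def, map_mul]
  ring

end BaseChange

end LeibnizYD

/-! ### Transport of the structure along a change of basis -/

namespace LeibnizYD

section Transport

variable {k B H H' A : Type*} [CommRing k] [Ring B] [Bialgebra k B] [Ring H] [Bialgebra k H]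
  [Ring H'] [Bialgebra k H'] [Ring A] [Algebra k A]

/-- If a bialgebra isomorphism intertwines two actions, it induces a multiplicative map of smash
products. -/
theorem smashMul_rTensor (θ : H' ≃ₐc[k] H) {act : A →ₗ[k] H →ₗ[k] A} {act' : A →ₗ[k] H' →ₗ[k] A}
    (hθ : ∀ a f, act a (θ f) = act' a f) (s t : H' ⊗[k] A) :
    smashMul act ((θ : H' →ₗ[k] H).rTensor A s) ((θ : H' →ₗ[k] H).rTensor A t) =
      (θ : H' →ₗ[k] H).rTensor A (smashMul act' s t) := by
  induction s with
  | zero => simp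
  | add x y hx hy => simp only [map_add, LinearMap.add_apply, hx, hy]
  | tmul f a =>
  induction t with
  | zero => simp
  | add x y hx hy => simp only [map_add, hx, hy]
  | tmul g c =>
    have h := CoalgHomClass.map_comp_comul_apply θ g
    rw [LinearMap.rTensor_tmul, LinearMap.rTensor_tmul, smashMul_tmul, smashMul_tmul]
    have h' : Coalgebra.comul (R := k) ((θ : H' →ₗ[k] H) g) =
        TensorProduct.map (θ : H' →ₗ[k] H) (θ : H' →ₗ[k] H) (Coalgebra.comul g) := h.symm
    rw [h']
    induction Coalgebra.comul (R := k) g with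
    | zero => simp
    | add x y hx hy => simp only [map_add, hx, hy]
    | tmul x y => simp [hθ]

end Transport

section BaseChange

variable {k h : Type*} [Field k] [AddCommGroup h] [Module k h] [LeftLeibnizAlgebra k h] {n : ℕ}
  {b b' : Module.Basis (Fin n) k h}

variable {P : ULie k h →ₗ[k] OAut b →ₗ[k] k} {P' : ULie k h →ₗ[k] OAut b' →ₗ[k] k}

theorem IsAdPairing.comp_baseChange (hP : IsAdPairing b P) :
    IsAdPairing b'
      (P.compl₂ ((baseChange b b' : OAut b' →ₐc[k] OAut b) : OAut b' →ₗ[k] OAut b)) := by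
  refine ⟨hP.1.comp _, fun i j l => ?_⟩
  change P (tilde k (b' l)) (baseChange b b' (genG b' i j)) = _
  have h1 := apply_eq_sum_repr b (b'.coord i) (lbr k h (b' l) (b' j))
  simp only [Module.Basis.coord_apply] at h1
  rw [baseChange_G, structConst, h1]
  simp only [map_sum, map_smul, hP.tilde_G, smul_eq_mul]
  refine Finset.sum_congr rfl fun p _ => ?_
  rw [repr_map_eq_sum b (lbr k h (b' l)) (b' j) p, Finset.sum_mul]
  refine Finset.sum_congr rfl fun q _ => ?_
  ring

theorem IsAdPairing.apply_baseChange (hP : IsAdPairing b P) (hP' : IsAdPairing b' P')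
    (u : ULie k h) (f : OAut b') : P u (baseChange b b' f) = P' u f :=
  LinearMap.congr_fun₂ (hP.comp_baseChange.unique hP') u f

theorem IsAdPairing.pairingAction_baseChange (hP : IsAdPairing b P) (hP' : IsAdPairing b' P')
    (u : ULie k h) (f : OAut b') :
    pairingAction P u (baseChange b b' f) = pairingAction P' u f := by
  have : P.flip (baseChange b b' f) = P'.flip f :=
    LinearMap.ext fun u => hP.apply_baseChange hP' u f
  rw [pairingAction_apply, pairingAction_apply, this]

theorem IsLambda.rTensor_baseChange (hP : IsAdPairing b P) (hP' : IsAdPairing b' P')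
    {lam' : ULie k h →ₗ[k] OAut b' ⊗[k] ULie k h} (hlam' : IsLambda b' (pairingAction P') lam') :
    IsLambda b (pairingAction P)
      ((baseChange b b' : OAut b' →ₗ[k] OAut b).rTensor (ULie k h) ∘ₗ lam') where
  map_one := by
    rw [LinearMap.comp_apply, hlam'.map_one, LinearMap.rTensor_tmul]
    exact congrArg (· ⊗ₜ[k] (1 : ULie k h)) (_root_.map_one (baseChange b b'))
  map_mul u v := by
    simp only [LinearMap.comp_apply]
    rw [smashMul_rTensor (baseChange b b') (hP.pairingAction_baseChange hP'), hlam'.map_mul]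
  map_gen j := by
    have h1 : ∀ m, ∑ q, b'.repr (b j) q * b.repr (b' q) m = if m = j then 1 else 0 := by
      intro m
      have := apply_eq_sum_repr b' (b.coord m) (b j)
      simp only [Module.Basis.coord_apply, Module.Basis.repr_self] at this
      rw [← this, Finsupp.single_apply]
      simp only [eq_comm]
    have h2 : ∀ p, (baseChange b b' : OAut b' →ₗ[k] OAut b)
        (∑ q, b'.repr (b j) q • genGbar b' p q) = ∑ l, b'.repr (b l) p • genGbar b l j := by
      intro p
      change (baseChange b b') _ = _
      rw [map_sum]
      simp only [map_smul, baseChange_Gbar, Finset.smul_sum, smul_smul]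
      rw [Finset.sum_comm]
      refine Finset.sum_congr rfl fun l _ => ?_
      rw [Finset.sum_comm]
      calc _ = ∑ m, (b'.repr (b l) p * ∑ q, b'.repr (b j) q * b.repr (b' q) m) •
            genGbar b l m := by
            refine Finset.sum_congr rfl fun m _ => ?_
            rw [Finset.mul_sum, Finset.sum_smul]
            refine Finset.sum_congr rfl fun q _ => congrArg (· • genGbar b l m) ?_
            ring
        _ = _ := by simp [h1]
    rw [LinearMap.comp_apply, tilde_eq_sum b' (b j), map_sum]
    simp only [map_smul, hlam'.map_gen, Finset.smul_sum, TensorProduct.smul_tmul']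
    rw [Finset.sum_comm]
    simp only [← TensorProduct.sum_tmul, map_sum, LinearMap.rTensor_tmul]
    simp only [← map_sum, h2, TensorProduct.sum_tmul]
    rw [Finset.sum_comm]
    refine Finset.sum_congr rfl fun l _ => ?_
    simp only [TensorProduct.smul_tmul, ← TensorProduct.tmul_sum]
    rw [← tilde_eq_sum b']

end BaseChange

end LeibnizYD

theorem theorem3p5 {k h : Type*} [Field k] [AddCommGroup h] [Module k h]
    [LeftLeibnizAlgebra k h] {n : ℕ} (b : Module.Basis (Fin n) k h) :
    (∃! P : ULie k h →ₗ[k] OAut b →ₗ[k] k, IsAdPairing b P) ∧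
    (∀ P : ULie k h →ₗ[k] OAut b →ₗ[k] k, IsAdPairing b P →
      IsRightModuleAlgebra (pairingAction P) ∧
      IsAssocUnital (smashMul (pairingAction P)) (1 ⊗ₜ[k] 1) ∧
      (∃! lam : ULie k h →ₗ[k] OAut b ⊗[k] ULie k h, IsLambda b (pairingAction P) lam) ∧
      ∀ lam : ULie k h →ₗ[k] OAut b ⊗[k] ULie k h, IsLambda b (pairingAction P) lam →
        (∀ u v, smashMul (pairingAction P) (lam u) (1 ⊗ₜ[k] v) =
          smashMul (pairingAction P) (1 ⊗ₜ[k] v) (lam u)) ∧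
        IsLeftCoaction lam ∧
        IsBraidedCommYDModuleAlgebra (pairingAction P) lam) ∧
    (∀ b' : Module.Basis (Fin n) k h, ∃ θ : OAut b' ≃ₐc[k] OAut b,
      (∀ i j, θ (genG b' i j) =
        ∑ l, ∑ m, (b'.repr (b l) i * b.repr (b' j) m) • genG b l m) ∧
      ∀ (P : ULie k h →ₗ[k] OAut b →ₗ[k] k) (P' : ULie k h →ₗ[k] OAut b' →ₗ[k] k),
        IsAdPairing b P → IsAdPairing b' P' →
          (∀ u f, P u (θ f) = P' u f) ∧
          (∀ u f, pairingAction P u (θ f) = pairingAction P' u f) ∧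
          (∀ s t, smashMul (pairingAction P)
              ((θ : OAut b' →ₗ[k] OAut b).rTensor (ULie k h) s)
              ((θ : OAut b' →ₗ[k] OAut b).rTensor (ULie k h) t) =
            (θ : OAut b' →ₗ[k] OAut b).rTensor (ULie k h)
              (smashMul (pairingAction P') s t)) ∧
          ∀ (lam : ULie k h →ₗ[k] OAut b ⊗[k] ULie k h)
            (lam' : ULie k h →ₗ[k] OAut b' ⊗[k] ULie k h),
            IsLambda b (pairingAction P) lam → IsLambda b' (pairingAction P') lam' →
              ∀ u, (θ : OAut b' →ₗ[k] OAut b).rTensor (ULie k h) (lam' u) = lam u) := by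

  refine ⟨⟨adPairing b, isAdPairing_adPairing b, fun P hP => hP.unique (isAdPairing_adPairing b)⟩,
    fun P hP => ?_, fun b' => ⟨baseChange b b', baseChange_G b b', fun P P' hP hP' => ?_⟩⟩
  · have hact := hP.1.isRightModuleAlgebra
    refine ⟨hact, hact.isAssocUnital_smashMul,
      ⟨_, hP.isLambda_lambdaHom, fun lam hlam => hlam.unique hP.isLambda_lambdaHom⟩,
      fun lam hlam => ?_⟩
    obtain rfl := hlam.unique hP.isLambda_lambdaHom
    refine ⟨fun u v => ?_, isLeftCoaction_lambdaHom, hP.isBraidedComm⟩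
    rw [hact.smashMul_one_tmul]
    exact (hP.smashMul_lambdaHom u _).symm
  · refine ⟨hP.apply_baseChange hP', hP.pairingAction_baseChange hP',
      smashMul_rTensor (baseChange b b') (hP.pairingAction_baseChange hP'),
      fun lam lam' hlam hlam' u => ?_⟩
    exact LinearMap.congr_fun ((hlam'.rTensor_baseChange hP hP').unique hlam) u
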